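/- Work in the hyperbolic plane $\mathbb{H}^2$ of curvature $-1$. Let $E_0,E_1$ be two horocycles with a common ideal point $\mathcal O$ at distance $\ln 2$ from each other, $E_0$ being the one nearer to $\mathcal O$, and let $\ell,\ell'$ be two different lines ending at $\mathcal O$. The prototile $B$ is the compact region bounded by $E_0,E_1,\ell,\ell'$. It is regarded as a pentagon: its edges are the arc $a$ on $E_0$, the two halves $b_1,b_2$ of the arc on $E_1$ (twice as long as $a$), and two straight edges of type $c$ on $\ell,\ell'$, which are oriented from $a$ towards the $b$-edges. Edge names are carried to every congruent copy of $B$ by the orientation-preserving isometry that takes $B$ to it. A *B-tiling* is a tiling $\mathcal T$ of $\mathbb{H}^2$ by congruent copies of $B$ which is edge-to-edge (any two different tiles that meet have exactly a common edge or a common vertex as intersection) and in which two tiles with a common $c$-edge induce the same orientation on it. A *horocyclic path* is a sequence of pairwise different tiles of $\mathcal T$ in which consecutive tiles share an edge that is not a $c$-edge. The set of all tiles that can be linked with a given tile by a finite horocyclic path is a *pool* of $\mathcal T$. The *tail* of a tile $T$ is the unique infinite horocyclic path $T=T_0,T_1,T_2,\dots$ such that for each $i\ge 1$ the $a$-edge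 of $T_{i-1}$ is a $b_1$- or $b_2$-edge of $T_i$; put $s(T)=(s_1,s_2,\dots)\in\{-1,1\}^{\mathbb N}$ with $s_i=1$ if the $a$-edge of $T_{i-1}$ is the $b_1$-edge of $T_i$, and $s_i=-1$ otherwise. The sequence $s(T)$ is *periodic* if there is $p\ge 1$ with $s_{i+p}=s_i$ for all $i\ge 1$. Let $\mathrm{Sym}(\mathcal T)$ be the group of all isometries $\varphi$ of $\mathbb{H}^2$ (orientation-preserving or not) with $\varphi(\mathcal T)=\mathcal T$. **Theorem.** Let $\mathcal T$ be a B-tiling of $\mathbb{H}^2$. Then $\mathrm{Sym}(\mathcal T)$ is * isomorphic to $\mathbb{Z}\times\mathcal C_2$, where $\mathcal C_2$ is the group of order two, if $\mathcal T$ has exactly two pools; * isomorphic to $\mathbb{Z}$ if $\mathcal T$ has exactly one pool and $s(T)$ is periodic for some tile $T\in\mathcal T$; * trivial otherwise. -/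

import Mathlib

open UpperHalfPlane

noncomputable section

namespace Boroczky

/-- The hyperbolic plane of curvature `-1` is the upper half-plane `ℍ` with Mathlib's metric.
The Böröczky prototile: the region between the two horocycles `im = 2` and `im = 1` (at distance
`log 2`, centred at the ideal point `∞`) and the two lines `re = 0` and `re = w` ending at the
same ideal point. The outer horocyclic arc `im = 1` has length `w`, the inner one `im = 2` has
length `w / 2`. -/
def prototile (w : ℝ) : Set ℍ :=
  {z | 0 ≤ z.re ∧ z.re ≤ w ∧ 1 ≤ z.im ∧ z.im ≤ 2}

/-- The names of the five edges of a Böröczky pentagon: the short horocyclic edge `a`, the two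
halves `b₁`, `b₂` of the long horocyclic arc, and the two straight edges of type `c`. -/
inductive EdgeName : Type
  | a
  | b₁
  | b₂
  | cLeft
  | cRight

/-- The five edges of the prototile. -/
def protoEdge (w : ℝ) : EdgeName → Set ℍ
  | .a => {z | 0 ≤ z.re ∧ z.re ≤ w ∧ z.im = 2}
  | .b₁ => {z | 0 ≤ z.re ∧ z.re ≤ w / 2 ∧ z.im = 1}
  | .b₂ => {z | w / 2 ≤ z.re ∧ z.re ≤ w ∧ z.im = 1}
  | .cLeft => {z | z.re = 0 ∧ 1 ≤ z.im ∧ z.im ≤ 2}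
  | .cRight => {z | z.re = w ∧ 1 ≤ z.im ∧ z.im ≤ 2}

/-- The five vertices of the prototile. -/
def protoVertices (w : ℝ) : Set ℍ :=
  {z | (z.im = 2 ∧ (z.re = 0 ∨ z.re = w)) ∨
    (z.im = 1 ∧ (z.re = 0 ∨ z.re = w / 2 ∨ z.re = w))}

/-- A Böröczky pentagon: a congruent copy of the prototile. -/
def IsTile (w : ℝ) (T : Set ℍ) : Prop :=
  ∃ φ : ℍ ≃ᵢ ℍ, φ '' prototile w = T

/-- `e` is the edge named `k` of the tile `T`. The names are carried from the prototile to `T`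
by the orientation-preserving isometry (an element of `SL(2,ℝ)`, unique up to sign) that moves
the prototile onto `T`; it exists because the prototile has a mirror symmetry. So `b₁` and `b₂`
are told apart in the same way in all tiles. -/
def IsEdge (w : ℝ) (k : EdgeName) (T e : Set ℍ) : Prop :=
  ∃ g : Matrix.SpecialLinearGroup (Fin 2) ℝ,
    (fun z : ℍ => g • z) '' prototile w = T ∧ (fun z : ℍ => g • z) '' protoEdge w k = e

/-- `v` is one of the five vertices of the tile `T`. -/
def IsVertex (w : ℝ) (T : Set ℍ) (v : ℍ) : Prop :=
  ∃ g : Matrix.SpecialLinearGroup (Fin 2) ℝ,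
    (fun z : ℍ => g • z) '' prototile w = T ∧ ∃ u ∈ protoVertices w, g • u = v

/-- `e` is an edge of `T` of type `b`. -/
def IsBEdge (w : ℝ) (T e : Set ℍ) : Prop :=
  IsEdge w .b₁ T e ∨ IsEdge w .b₂ T e

/-- `e` is a straight edge of `T`, i.e. of type `c`. -/
def IsCEdge (w : ℝ) (T e : Set ℍ) : Prop :=
  IsEdge w .cLeft T e ∨ IsEdge w .cRight T e

/-- `e` is an edge of `T` which is not a `c`-edge. -/
def IsHorocyclicEdge (w : ℝ) (T e : Set ℍ) : Prop :=
  IsEdge w .a T e ∨ IsBEdge w T e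

/-- A Böröczky tiling: an edge-to-edge tiling of the hyperbolic plane by Böröczky pentagons that
respects the orientation of the `c`-edges. A `c`-edge of `T` is oriented away from the `a`-edge
of `T`, so that its initial point is the point it has in common with the `a`-edge. -/
structure IsBTiling (w : ℝ) (𝒯 : Set (Set ℍ)) : Prop where
  isTile : ∀ T ∈ 𝒯, IsTile w T
  covers : ⋃₀ 𝒯 = Set.univ
  nonoverlapping : ∀ T ∈ 𝒯, ∀ T' ∈ 𝒯, T ≠ T' → Disjoint (interior T) (interior T')
  edgeToEdge : ∀ T ∈ 𝒯, ∀ T' ∈ 𝒯, T ≠ T' → (T ∩ T').Nonempty →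
    (∃ k k' : EdgeName, IsEdge w k T (T ∩ T') ∧ IsEdge w k' T' (T ∩ T')) ∨
    (∃ v : ℍ, T ∩ T' = {v} ∧ IsVertex w T v ∧ IsVertex w T' v)
  oriented : ∀ T ∈ 𝒯, ∀ T' ∈ 𝒯, ∀ e f f' : Set ℍ, IsCEdge w T e → IsCEdge w T' e →
    IsEdge w .a T f → IsEdge w .a T' f' → e ∩ f = e ∩ f'

/-- `p 0, …, p n` is a (finite) horocyclic path in `𝒯`: the tiles are pairwise different and
consecutive tiles share an edge which is not a `c`-edge. -/
def IsHorocyclicPath (w : ℝ) (𝒯 : Set (Set ℍ)) (n : ℕ) (p : ℕ → Set ℍ) : Prop :=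
  (∀ i ≤ n, p i ∈ 𝒯) ∧ Set.InjOn p (Set.Iic n) ∧
    ∀ i < n, ∃ e, IsHorocyclicEdge w (p i) e ∧ IsHorocyclicEdge w (p (i + 1)) e

/-- The pool of `T`: all tiles linked with `T` by a horocyclic path. -/
def pool (w : ℝ) (𝒯 : Set (Set ℍ)) (T : Set ℍ) : Set (Set ℍ) :=
  {T' | ∃ n p, IsHorocyclicPath w 𝒯 n p ∧ p 0 = T ∧ p n = T'}

/-- The set of all pools of the tiling. -/
def pools (w : ℝ) (𝒯 : Set (Set ℍ)) : Set (Set (Set ℍ)) :=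
  pool w 𝒯 '' 𝒯

/-- A step down: the `a`-edge of `T` is a `b`-edge of `T'`. -/
def StepDown (w : ℝ) (T T' : Set ℍ) : Prop :=
  ∃ e, IsEdge w .a T e ∧ IsBEdge w T' e

/-- `t` is the tail of `T`: the infinite horocyclic path down-down-down-⋯ starting at `T`. -/
def IsTail (w : ℝ) (𝒯 : Set (Set ℍ)) (T : Set ℍ) (t : ℕ → Set ℍ) : Prop :=
  t 0 = T ∧ (∀ i, t i ∈ 𝒯) ∧ Function.Injective t ∧ ∀ i, StepDown w (t i) (t (i + 1))

open Classical in
/-- The `±1`-sequence of a tail `(T₀, T₁, …)`; the entry at `i` (counted from `0`) is `1` if the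
`a`-edge of `T_i` is the `b₁`-edge of `T_{i+1}`, and `-1` otherwise. -/
def tailSeq (w : ℝ) (t : ℕ → Set ℍ) (i : ℕ) : ℤ :=
  if ∃ e, IsEdge w .a (t i) e ∧ IsEdge w .b₁ (t (i + 1)) e then 1 else -1

/-- The sequence of some tile of the tiling is (purely) periodic. -/
def HasPeriodicTailSeq (w : ℝ) (𝒯 : Set (Set ℍ)) : Prop :=
  ∃ T ∈ 𝒯, ∃ t, IsTail w 𝒯 T t ∧ ∃ p : ℕ, 0 < p ∧ Function.Periodic (tailSeq w t) p

/-- The symmetry group of `𝒯`: all isometries `φ` of the hyperbolic plane, orientation-preserving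
or not, with `φ(𝒯) = 𝒯`. -/
def symmetryGroup (𝒯 : Set (Set ℍ)) : Subgroup (ℍ ≃ᵢ ℍ) where
  carrier := {φ | (fun T : Set ℍ => φ '' T) '' 𝒯 = 𝒯}
  one_mem' := by
    have h : (fun T : Set ℍ => (1 : ℍ ≃ᵢ ℍ) '' T) = id := by
      funext T
      exact Set.image_id T
    simp only [Set.mem_ofPred_eq, h, Set.image_id]
  mul_mem' := by
    intro φ ψ hφ hψ
    have h : (fun T : Set ℍ => (φ * ψ) '' T)
        = (fun T : Set ℍ => φ '' T) ∘ (fun T : Set ℍ => ψ '' T) := by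
      funext T
      exact Set.image_comp φ ψ T
    simp only [Set.mem_ofPred_eq] at *
    rw [h, Set.image_comp, hψ, hφ]
  inv_mem' := by
    intro φ hφ
    have h : (fun T : Set ℍ => (φ⁻¹ : ℍ ≃ᵢ ℍ) '' T) ∘ (fun T : Set ℍ => φ '' T) = id := by
      funext T
      have hc : ((φ⁻¹ : ℍ ≃ᵢ ℍ) : ℍ → ℍ) ∘ φ = id := by
        funext z
        exact φ.symm_apply_apply z
      change (φ⁻¹ : ℍ ≃ᵢ ℍ) '' (φ '' T) = T
      rw [← Set.image_comp, hc, Set.image_id]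
    simp only [Set.mem_ofPred_eq] at *
    conv_lhs => rw [← hφ]
    rw [← Set.image_comp, h, Set.image_id]

end Boroczky

end

open scoped Pointwise MatrixGroups

noncomputable section

namespace Boroczky

/-! Put the common ideal point of one tile at `∞`. A horocyclic arc can only be matched with an arc
of a horocycle with the same centre, and the orientation condition rules out turning a `c`-edge
round. So each neighbour across an edge is again upright, obtained by an affine map `z ↦ 2 ^ k z +
t`, and up to an isometry the whole tiling consists of the rectangles `[t, t + 2 ^ k w] × [2 ^ k, 2
^ (k + 1)]`. It is encoded by the sets `L k` of left ends at level `k`: each is a coset of `2 ^ k w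
ℤ`, and `L (k + 1) ⊆ L k` (`IsBTiling.exists_grid`).

Horocyclic paths only go from a tile to the one above it or to one of the two below it. Two tiles
are linked exactly when they have a common ancestor. This fails only if grid points of arbitrarily
high level separate them; since the spacing `2 ^ k w` grows, these points stabilise to some `x` in
every `L k`. There is at most one such `x`, so the number of pools is two if it exists and one
otherwise (`encard_pools_eq_two`, `encard_pools_eq_one`).

A symmetry must be affine, `x ↦ σ 2 ^ m x + t` on the boundary with `σ = ±1`, and has to carry `L k`
to `L (k + m)`. A nonzero translation (`σ = 1`, `m = 0`) is impossible because the spacing is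
unbounded; a reflection (`σ = -1`, `m = 0`) forces its centre `t / 2` into every `L k`. With one
pool, `m` therefore embeds the group into `ℤ`. With two pools, `L k = x + 2 ^ k w ℤ`, and every
choice of `σ` and `m` is realised by exactly one map, the one fixing `x`.

With one pool it remains to link nontrivial symmetries to periodic tails. A symmetry with `σ = 1`
and `m = p > 0` fixes a real `c`; it shifts the column of tiles over `c` by `p` levels, so that
column is a tail of period `p`. Conversely, a tail with period `p` is mapped into itself by an
affine map of factor `2 ^ p`, and a tail determines all of `L` because the cosets are nested. -/

/-- The point of the upper half-plane with coordinates `x` and `y`. -/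
def pt (x y : ℝ) (hy : 0 < y) : ℍ := ⟨⟨x, y⟩, hy⟩

@[simp] lemma pt_re (x y : ℝ) (hy : 0 < y) : (pt x y hy).re = x := rfl

@[simp] lemma pt_im (x y : ℝ) (hy : 0 < y) : (pt x y hy).im = y := rfl

lemma continuous_pt_comp {X : Type*} [TopologicalSpace X] {x y : X → ℝ} (hx : Continuous x)
    (hy : Continuous y) (h : ∀ s, 0 < y s) : Continuous fun s => pt (x s) (y s) (h s) := by
  rw [UpperHalfPlane.isEmbedding_coe.continuous_iff]
  have : ((↑) : ℍ → ℂ) ∘ (fun s => pt (x s) (y s) (h s)) = fun s => (x s : ℂ) + y s * Complex.I := by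
    funext s
    apply Complex.ext <;> simp [pt]
  rw [this]
  fun_prop

/-- Starting from a point of an open set one can move a little in any direction. -/
lemma exists_small_move {U : Set ℍ} (hU : IsOpen U) {p : ℍ} (hp : p ∈ U) (u v : ℝ) :
    ∃ s : ℝ, 0 < s ∧ s < 1 ∧ ∃ z ∈ U, z.re = p.re + s * u ∧ z.im = p.im + s * v := by
  have hpos := p.im_pos
  -- The maximum keeps the point in the half-plane for every `s`; for small `s` it has no effect.
  have hc : Continuous fun s : ℝ => pt (p.re + s * u) (max (p.im + s * v) (p.im / 2))
      (lt_max_of_lt_right (by positivity)) :=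
    continuous_pt_comp (by fun_prop) (by fun_prop) _
  have h1 : ∀ᶠ s in nhds (0 : ℝ), pt (p.re + s * u) (max (p.im + s * v) (p.im / 2))
      (lt_max_of_lt_right (by positivity)) ∈ U := by
    refine hc.continuousAt.eventually_mem (hU.mem_nhds ?_)
    convert hp using 1
    apply UpperHalfPlane.ext_re_im <;> simp [hpos.le]
  have h2 : ∀ᶠ s in nhds (0 : ℝ), p.im / 2 < p.im + s * v := by
    have : Continuous fun s : ℝ => p.im + s * v := by fun_prop
    refine this.continuousAt.eventually_const_lt ?_
    simpa using hpos
  have h3 : ∀ᶠ s in nhds (0 : ℝ), s < 1 := Iio_mem_nhds one_pos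
  obtain ⟨s, ⟨hs1, hs2, hs3⟩, hs⟩ :=
    (((h1.and (h2.and h3)).filter_mono nhdsWithin_le_nhds).and
      (self_mem_nhdsWithin : Set.Ioi (0 : ℝ) ∈ nhdsWithin 0 (Set.Ioi 0))).exists
  exact ⟨s, hs, hs3, _, hs1, rfl, by simp [hs2.le]⟩

/-! ### Möbius transformations in real coordinates -/

section Coordinates

/-- The squared norm of the denominator of a Möbius transformation. -/
lemma denom_sq_pos (g : SL(2, ℝ)) (z : ℍ) :
    0 < (g 1 0 * z.re + g 1 1) ^ 2 + (g 1 0 * z.im) ^ 2 := by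
  have hdet := g.det_coe
  rw [Matrix.det_fin_two] at hdet
  have hz := z.im_pos
  by_cases hc : g 1 0 = 0
  · have : g 1 1 ≠ 0 := by
      rintro h
      simp [hc, h] at hdet
    simp only [hc, zero_mul, zero_add]
    positivity
  · positivity

lemma sl_im (g : SL(2, ℝ)) (z : ℍ) :
    (g • z).im = z.im / ((g 1 0 * z.re + g 1 1) ^ 2 + (g 1 0 * z.im) ^ 2) := by
  have hdet := g.det_coe
  rw [Matrix.det_fin_two] at hdet
  rw [← coe_im, coe_specialLinearGroup_apply]
  simp only [Algebra.algebraMap_self, RingHom.id_apply, Complex.div_im, Complex.normSq_apply,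
    Complex.add_re, Complex.mul_re, Complex.ofReal_re, Complex.ofReal_im, Complex.add_im,
    Complex.mul_im, coe_re, coe_im]
  have := denom_sq_pos g z
  rw [← sub_div]
  congr 1
  · linear_combination z.im * hdet
  · ring

lemma sl_re (g : SL(2, ℝ)) (z : ℍ) :
    (g • z).re = ((g 0 0 * z.re + g 0 1) * (g 1 0 * z.re + g 1 1) + g 0 0 * g 1 0 * z.im ^ 2) /
      ((g 1 0 * z.re + g 1 1) ^ 2 + (g 1 0 * z.im) ^ 2) := by
  rw [← coe_re, coe_specialLinearGroup_apply]
  simp only [Algebra.algebraMap_self, RingHom.id_apply, Complex.div_re, Complex.normSq_apply,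
    Complex.add_re, Complex.mul_re, Complex.ofReal_re, Complex.ofReal_im, Complex.add_im,
    Complex.mul_im, coe_re, coe_im]
  rw [← add_div]
  congr 1 <;> ring

/-- A Möbius transformation fixing the ideal point `∞` acts by an affine map. -/
lemma affine_of_lower_left_eq_zero {g : SL(2, ℝ)} (hg : g 1 0 = 0) :
    ∃ α β : ℝ, 0 < α ∧ ∀ z : ℍ, (g • z).re = α * z.re + β ∧ (g • z).im = α * z.im := by
  have hdet := g.det_coe
  rw [Matrix.det_fin_two, hg] at hdet
  have hd : g 1 1 ≠ 0 := by
    rintro h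
    simp [h] at hdet
  have ha : g 0 0 = 1 / g 1 1 := by
    field_simp
    linarith
  refine ⟨1 / g 1 1 ^ 2, g 0 1 / g 1 1, by positivity, fun z => ⟨?_, ?_⟩⟩
  · rw [sl_re, hg, ha]
    field_simp
    ring
  · rw [sl_im, hg]
    field_simp
    ring

lemma quadratic_coeffs_eq_zero {A B C : ℝ} {S : Set ℝ} (hS : S.Infinite)
    (h : ∀ x ∈ S, A * x ^ 2 + B * x + C = 0) : A = 0 ∧ B = 0 ∧ C = 0 := by
  obtain ⟨x, hx⟩ := hS.nonempty
  obtain ⟨y, hy, hyx⟩ := hS.exists_notMem_finite (Set.finite_singleton x)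
  obtain ⟨z, hz, hzx⟩ := hS.exists_notMem_finite (Set.toFinite {x, y})
  simp only [Set.mem_singleton_iff, Set.mem_insert_iff, not_or] at hyx hzx
  have e1 := h x hx
  have e2 := h y hy
  have e3 := h z hz
  have f1 : A * (x + y) + B = 0 := by
    apply mul_left_cancel₀ (sub_ne_zero.2 hyx)
    linear_combination e2 - e1
  have f2 : A * (x + z) + B = 0 := by
    apply mul_left_cancel₀ (sub_ne_zero.2 hzx.1)
    linear_combination e3 - e1
  have hA : A = 0 := by
    apply mul_left_cancel₀ (sub_ne_zero.2 hzx.2)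
    linear_combination f2 - f1
  subst hA
  have hB : B = 0 := by linarith
  subst hB
  exact ⟨rfl, rfl, by linarith⟩

/-- If infinitely many points of a horizontal line are moved to another horizontal line, then `∞`
is fixed. -/
lemma lower_left_eq_zero_of_horizontal {g : SL(2, ℝ)} {y h : ℝ} (hh : 0 < h) {S : Set ℍ}
    (hS : S.Infinite) (hy : ∀ z ∈ S, z.im = y) (hg : ∀ z ∈ S, (g • z).im = h) : g 1 0 = 0 := by
  have hinj : Set.InjOn UpperHalfPlane.re S := fun z hz z' hz' e =>
    UpperHalfPlane.ext_re_im e ((hy z hz).trans (hy z' hz').symm)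
  have := quadratic_coeffs_eq_zero (A := h * g 1 0 ^ 2) (B := h * (2 * g 1 0 * g 1 1))
    (C := h * (g 1 1 ^ 2 + (g 1 0 * y) ^ 2) - y) (hS.image hinj) (by
      rintro _ ⟨z, hz, rfl⟩
      have e := hg z hz
      have := denom_sq_pos g z
      rw [sl_im, div_eq_iff this.ne', hy z hz] at e
      linear_combination -e)
  simpa [hh.ne'] using this.1

/-- A horizontal line never meets the preimage of a vertical line in infinitely many points. -/
lemma not_horizontal_to_vertical {g : SL(2, ℝ)} {y r : ℝ} {S : Set ℍ}
    (hS : S.Infinite) (hy : ∀ z ∈ S, z.im = y) (hg : ∀ z ∈ S, (g • z).re = r) : False := by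
  have hinj : Set.InjOn UpperHalfPlane.re S := fun z hz z' hz' e =>
    UpperHalfPlane.ext_re_im e ((hy z hz).trans (hy z' hz').symm)
  have hdet := g.det_coe
  rw [Matrix.det_fin_two] at hdet
  obtain ⟨h1, h2, -⟩ := quadratic_coeffs_eq_zero (A := g 0 0 * g 1 0 - r * g 1 0 ^ 2)
    (B := g 0 0 * g 1 1 + g 0 1 * g 1 0 - r * (2 * g 1 0 * g 1 1))
    (C := g 0 1 * g 1 1 + g 0 0 * g 1 0 * y ^ 2 - r * (g 1 1 ^ 2 + (g 1 0 * y) ^ 2))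
    (hS.image hinj) (by
      rintro _ ⟨z, hz, rfl⟩
      have e := hg z hz
      have := denom_sq_pos g z
      rw [sl_re, div_eq_iff this.ne', hy z hz] at e
      linear_combination e)
  by_cases hc : g 1 0 = 0
  · rw [hc] at h2 hdet
    linarith
  · have ha : g 0 0 = r * g 1 0 := by
      apply mul_right_cancel₀ hc
      linear_combination h1
    have hb : g 0 1 = r * g 1 1 := by
      apply mul_right_cancel₀ hc
      rw [ha] at h2
      linear_combination h2
    rw [ha, hb] at hdet
    linarith

/-- A Möbius transformation moving a vertical line onto a vertical line fixes `∞` or moves the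
end point of the line to `∞`. -/
lemma vertical_to_vertical {g : SL(2, ℝ)} {x r : ℝ} (hg : ∀ z : ℍ, z.re = x → 1 ≤ z.im →
    z.im ≤ 2 → (g • z).re = r) : g 1 0 = 0 ∨ g 1 0 * x + g 1 1 = 0 := by
  have hdet := g.det_coe
  rw [Matrix.det_fin_two] at hdet
  have key : ∀ y : ℝ, ∀ (hy : 1 ≤ y), y ≤ 2 →
      (g 0 0 * x + g 0 1) * (g 1 0 * x + g 1 1) + g 0 0 * g 1 0 * y ^ 2 =
      r * ((g 1 0 * x + g 1 1) ^ 2 + (g 1 0 * y) ^ 2) := by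
    intro y hy hy'
    have e := hg (pt x y (by linarith)) rfl hy hy'
    have := denom_sq_pos g (pt x y (by linarith))
    rwa [sl_re, div_eq_iff this.ne', pt_re, pt_im] at e
  have k1 := key 1 le_rfl one_le_two
  have k2 := key 2 one_le_two le_rfl
  by_contra! hne
  have ha : g 0 0 = r * g 1 0 := by
    apply mul_right_cancel₀ hne.1
    linear_combination (k2 - k1) / 3
  have hb : g 0 0 * x + g 0 1 = r * (g 1 0 * x + g 1 1) := by
    apply mul_right_cancel₀ hne.2
    rw [ha] at k1 ⊢
    linear_combination k1
  have : (g 0 0 * x + g 0 1) * g 1 0 - g 0 0 * (g 1 0 * x + g 1 1) = 0 := by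
    rw [hb, ha]
    ring
  linarith

end Coordinates


/-! ### The prototile has no orientation-preserving symmetries -/

section Prototile

variable {w : ℝ}

lemma interior_prototile_of {z : ℍ} (h : 0 < z.re ∧ z.re < w ∧ 1 < z.im ∧ z.im < 2) :
    z ∈ interior (prototile w) := by
  rw [mem_interior]
  refine ⟨{z : ℍ | 0 < z.re ∧ z.re < w ∧ 1 < z.im ∧ z.im < 2}, ?_, ?_, h⟩
  · intro z hz
    exact ⟨hz.1.le, hz.2.1.le, hz.2.2.1.le, hz.2.2.2.le⟩
  · exact (isOpen_lt continuous_const continuous_re).inter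
      ((isOpen_lt continuous_re continuous_const).inter
        ((isOpen_lt continuous_const continuous_im).inter
          (isOpen_lt continuous_im continuous_const)))

/-- An interior point can be moved a little in the directions `(1, 1)` and `(-1, -1)` without
leaving the rectangle, which makes all four inequalities strict. -/
lemma mem_interior_prototile {z : ℍ} :
    z ∈ interior (prototile w) ↔ 0 < z.re ∧ z.re < w ∧ 1 < z.im ∧ z.im < 2 := by
  refine ⟨fun h => ?_, interior_prototile_of⟩
  have hm : ∀ u v : ℝ, ∃ s : ℝ, 0 < s ∧ 0 ≤ z.re + s * u ∧ z.re + s * u ≤ w ∧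
      1 ≤ z.im + s * v ∧ z.im + s * v ≤ 2 := by
    intro u v
    obtain ⟨s, hs, -, z', hz', h1, h2⟩ := exists_small_move isOpen_interior h u v
    have h3 := interior_subset hz'
    refine ⟨s, hs, ?_⟩
    rw [← h1, ← h2]
    exact h3
  obtain ⟨s, hs, h1⟩ := hm 1 1
  obtain ⟨s', hs', h2⟩ := hm (-1) (-1)
  refine ⟨?_, ?_, ?_, ?_⟩ <;> linarith

lemma isClosed_prototile : IsClosed (prototile w) :=
  (isClosed_le continuous_const continuous_re).inter
    ((isClosed_le continuous_re continuous_const).inter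
      ((isClosed_le continuous_const continuous_im).inter
        (isClosed_le continuous_im continuous_const)))

/-- Any point moved slightly towards the centre `(w / 2, 3 / 2)` becomes interior. -/
lemma prototile_subset_closure_interior (hw : 0 < w) :
    prototile w ⊆ closure (interior (prototile w)) := by
  intro z hz
  rw [mem_closure_iff]
  intro U hU hzU
  obtain ⟨s, hs, hs1, z', hz', h1, h2⟩ := exists_small_move hU hzU (w / 2 - z.re) (3 / 2 - z.im)
  refine ⟨z', hz', ?_⟩
  obtain ⟨a, b, c, d⟩ := hz
  rw [mem_interior_prototile, h1, h2]
  refine ⟨?_, ?_, ?_, ?_⟩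
  · nlinarith [mul_nonneg (sub_nonneg.2 hs1.le) a]
  · nlinarith [mul_nonneg (sub_nonneg.2 hs1.le) (sub_nonneg.2 b)]
  · nlinarith [mul_nonneg (sub_nonneg.2 hs1.le) (sub_nonneg.2 c)]
  · nlinarith [mul_nonneg (sub_nonneg.2 hs1.le) (sub_nonneg.2 d)]

lemma protoEdge_subset (hw : 0 < w) (k : EdgeName) : protoEdge w k ⊆ prototile w := by
  rintro z hz
  cases k <;> simp only [protoEdge, Set.mem_ofPred_eq] at hz <;>
    refine ⟨?_, ?_, ?_, ?_⟩ <;> linarith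

lemma protoEdge_notMem_interior {k : EdgeName} {z : ℍ} (hz : z ∈ protoEdge w k) :
    z ∉ interior (prototile w) := by
  rw [mem_interior_prototile]
  rintro ⟨h1, h2, h3, h4⟩
  cases k <;> simp only [protoEdge, Set.mem_ofPred_eq] at hz <;> linarith

lemma infinite_horizontal {a b y : ℝ} (hab : a < b) (hy : 0 < y) :
    {z : ℍ | a ≤ z.re ∧ z.re ≤ b ∧ z.im = y}.Infinite := by
  have : Set.InjOn (fun x => pt x y hy) (Set.Icc a b) := fun x _ x' _ h => by
    simpa using congrArg UpperHalfPlane.re h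
  refine ((Set.Icc_infinite hab).image this).mono ?_
  rintro _ ⟨x, hx, rfl⟩
  exact ⟨hx.1, hx.2, rfl⟩

lemma infinite_protoEdge_a (hw : 0 < w) : (protoEdge w .a).Infinite :=
  infinite_horizontal hw two_pos

/-- The `a`-edge goes into the boundary, so infinitely many of its points land on one of the four
sides. A vertical side is impossible for a horocyclic arc, and a horizontal one forces `∞` to be
fixed. -/
lemma lower_left_eq_zero_of_stabilizer (hw : 0 < w) {g : SL(2, ℝ)}
    (hg : g • prototile w = prototile w) : g 1 0 = 0 := by
  have hfr : ∀ z ∈ protoEdge w .a, (g • z).re = 0 ∨ (g • z).re = w ∨ (g • z).im = 1 ∨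
      (g • z).im = 2 := by
    intro z hz
    have h1 : g • z ∈ prototile w := by
      rw [← hg]
      exact Set.smul_mem_smul_set (protoEdge_subset hw _ hz)
    have h2 : g • z ∉ interior (prototile w) := by
      rw [← hg, interior_smul, Set.smul_mem_smul_set_iff]
      exact protoEdge_notMem_interior hz
    rw [mem_interior_prototile] at h2
    obtain ⟨a, b, c, d⟩ := h1
    by_contra! hne
    exact h2 ⟨lt_of_le_of_ne a hne.1.symm, lt_of_le_of_ne b hne.2.1,
      lt_of_le_of_ne c hne.2.2.1.symm, lt_of_le_of_ne d hne.2.2.2⟩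
  have hcov : protoEdge w .a ⊆ {z ∈ protoEdge w .a | (g • z).re = 0} ∪
      ({z ∈ protoEdge w .a | (g • z).re = w} ∪ ({z ∈ protoEdge w .a | (g • z).im = 1} ∪
        {z ∈ protoEdge w .a | (g • z).im = 2})) := by
    intro z hz
    rcases hfr z hz with h | h | h | h
    · exact Or.inl ⟨hz, h⟩
    · exact Or.inr (Or.inl ⟨hz, h⟩)
    · exact Or.inr (Or.inr (Or.inl ⟨hz, h⟩))
    · exact Or.inr (Or.inr (Or.inr ⟨hz, h⟩))
  have hinf := (infinite_protoEdge_a hw).mono hcov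
  rw [Set.infinite_union, Set.infinite_union, Set.infinite_union] at hinf
  have hy : ∀ z ∈ protoEdge w .a, z.im = 2 := fun z hz => hz.2.2
  rcases hinf with h | h | h | h
  · exact (not_horizontal_to_vertical h (fun z hz => hy z hz.1) fun z hz => hz.2).elim
  · exact (not_horizontal_to_vertical h (fun z hz => hy z hz.1) fun z hz => hz.2).elim
  · exact lower_left_eq_zero_of_horizontal one_pos h (fun z hz => hy z hz.1) fun z hz => hz.2
  · exact lower_left_eq_zero_of_horizontal two_pos h (fun z hz => hy z hz.1) fun z hz => hz.2

/-- For an affine map it suffices that the opposite corners `(0, 1)` and `(w, 2)` stay in the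
rectangle: this bounds the factor and the shift from both sides. -/
lemma smul_eq_of_stabilizer (hw : 0 < w) {g : SL(2, ℝ)}
    (hg : g • prototile w = prototile w) (z : ℍ) : g • z = z := by
  obtain ⟨α, β, hα, h⟩ := affine_of_lower_left_eq_zero (lower_left_eq_zero_of_stabilizer hw hg)
  have hmem : ∀ x y : ℝ, ∀ hy : 0 < y, pt x y hy ∈ prototile w →
      0 ≤ α * x + β ∧ α * x + β ≤ w ∧ 1 ≤ α * y ∧ α * y ≤ 2 := by
    intro x y hy hp
    have h1 : g • pt x y hy ∈ prototile w := by
      rw [← hg]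
      exact Set.smul_mem_smul_set hp
    obtain ⟨e1, e2⟩ := h (pt x y hy)
    simp only [pt_re, pt_im] at e1 e2
    rw [← e1, ← e2]
    exact h1
  have h1 := hmem 0 1 one_pos ⟨by simp, by simpa using hw.le, by simp, by simp⟩
  have h2 := hmem w 2 two_pos ⟨by simpa using hw.le, by simp, by simp, by simp⟩
  have hα1 : α = 1 := by linarith
  have hβ : β = 0 := by
    subst hα1
    linarith
  obtain ⟨e1, e2⟩ := h z
  apply UpperHalfPlane.ext_re_im
  · rw [e1, hα1, hβ]
    ring
  · rw [e2, hα1, one_mul]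

lemma smul_eq_smul_of_prototile (hw : 0 < w) {g h : SL(2, ℝ)}
    (e : g • prototile w = h • prototile w) (z : ℍ) : g • z = h • z := by
  have h1 : (h⁻¹ * g) • prototile w = prototile w := by
    rw [mul_smul, e, inv_smul_smul]
  have := smul_eq_of_stabilizer hw h1 z
  rwa [mul_smul, inv_smul_eq_iff] at this

lemma smul_set_eq_smul_set_of_prototile (hw : 0 < w) {g h : SL(2, ℝ)}
    (e : g • prototile w = h • prototile w) (S : Set ℍ) : g • S = h • S :=
  Set.image_congr fun z _ => smul_eq_smul_of_prototile hw e z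

/-- Since the stabiliser of the prototile acts trivially, edge names do not depend on the group
element that represents a tile. -/
lemma isEdge_smul_iff (hw : 0 < w) {k : EdgeName} {g : SL(2, ℝ)} {e : Set ℍ} :
    IsEdge w k (g • prototile w) e ↔ e = g • protoEdge w k := by
  constructor
  · rintro ⟨h, h1, rfl⟩
    exact smul_set_eq_smul_set_of_prototile hw h1 _
  · rintro rfl
    exact ⟨g, rfl, rfl⟩

lemma isVertex_smul_iff (hw : 0 < w) {g : SL(2, ℝ)} {v : ℍ} :
    IsVertex w (g • prototile w) v ↔ g⁻¹ • v ∈ protoVertices w := by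
  constructor
  · rintro ⟨h, h1, u, hu, rfl⟩
    rwa [smul_eq_smul_of_prototile hw h1, inv_smul_smul]
  · intro h
    exact ⟨g, rfl, _, h, smul_inv_smul _ _⟩

end Prototile

/-! ### Isometries fixing two points -/

section Reflection

/-- The reflection in the imaginary axis. -/
def reflIso : ℍ ≃ᵢ ℍ where
  toFun z := pt (-z.re) z.im z.im_pos
  invFun z := pt (-z.re) z.im z.im_pos
  left_inv z := by apply UpperHalfPlane.ext_re_im <;> simp
  right_inv z := by apply UpperHalfPlane.ext_re_im <;> simp
  isometry_toFun := by
    refine Isometry.of_dist_eq fun z z' => ?_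
    have h := Real.cosh_strictMonoOn.injOn
    refine h (Set.mem_Ici.2 dist_nonneg) (Set.mem_Ici.2 dist_nonneg) ?_
    rw [cosh_dist', cosh_dist']
    simp only [pt_re, pt_im]
    congr 3
    ring

@[simp] lemma reflIso_re (z : ℍ) : (reflIso z).re = -z.re := rfl

@[simp] lemma reflIso_im (z : ℍ) : (reflIso z).im = z.im := rfl

/-- The isometry given by a Möbius transformation. -/
def slIso : SL(2, ℝ) →* (ℍ ≃ᵢ ℍ) where
  toFun g := IsometryEquiv.constSMul g
  map_one' := by
    ext z
    simp
  map_mul' g h := by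
    ext z
    simp [mul_smul]

@[simp] lemma slIso_apply (g : SL(2, ℝ)) (z : ℍ) : slIso g z = g • z := rfl

/-- Both distance equations involve the same `re² + im²`; comparing them determines `im`, and then
`re²`. -/
lemma eq_or_eq_refl_of_dist {z z' : ℍ} (h1 : dist z' I = dist z I)
    (h2 : dist z' (pt 0 2 two_pos) = dist z (pt 0 2 two_pos)) : z' = z ∨ z' = reflIso z := by
  have e1 := congrArg Real.cosh h1
  have e2 := congrArg Real.cosh h2
  have hz := z.im_pos
  have hz' := z'.im_pos
  rw [cosh_dist', cosh_dist'] at e1 e2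
  simp only [pt_re, pt_im, I_re, I_im] at e1 e2
  field_simp at e1 e2
  have him : z'.im = z.im := by linarith
  have hre : z'.re ^ 2 = z.re ^ 2 := by
    rw [him] at e1
    rw [mul_comm] at e1
    have := mul_left_cancel₀ hz.ne' e1
    simp only [sub_zero] at this
    linarith
  rcases sq_eq_sq_iff_eq_or_eq_neg.1 hre with h | h
  · exact Or.inl (UpperHalfPlane.ext_re_im h him)
  · exact Or.inr (UpperHalfPlane.ext_re_im h him)

/-- An isometry fixing `i` and `2i` is the identity or the reflection in the imaginary axis. -/
lemma eq_one_or_eq_refl {φ : ℍ ≃ᵢ ℍ} (h1 : φ I = I)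
    (h2 : φ (pt 0 2 two_pos) = pt 0 2 two_pos) : φ = 1 ∨ φ = reflIso := by
  have key : ∀ z, φ z = z ∨ φ z = reflIso z := fun z => by
    apply eq_or_eq_refl_of_dist
    · conv_lhs => rw [← h1, φ.isometry.dist_eq]
    · conv_lhs => rw [← h2, φ.isometry.dist_eq]
  have hinj := Real.cosh_strictMonoOn.injOn
  -- The choice between identity and reflection is so far made pointwise. The image of `1 + i`,
  -- which is off the axis, fixes it for all points.
  have far : ∀ z : ℍ, dist (reflIso z) (pt 1 1 one_pos) = dist z (pt 1 1 one_pos) → z.re = 0 := by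
    intro z h
    have e := congrArg Real.cosh h
    have hz := z.im_pos
    rw [cosh_dist', cosh_dist'] at e
    simp only [pt_re, pt_im, reflIso_re, reflIso_im] at e
    field_simp at e
    linarith
  have fix : ∀ z : ℍ, z.re = 0 → reflIso z = z := by
    intro z hz
    apply UpperHalfPlane.ext_re_im <;> simp [hz]
  rcases key (pt 1 1 one_pos) with h | h
  · left
    ext1 z
    rcases key z with hz | hz
    · exact hz
    · have := φ.isometry.dist_eq z (pt 1 1 one_pos)
      rw [h, hz] at this
      rw [hz, fix z (far z this)]
      rfl
  · right
    ext1 z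
    rcases key z with hz | hz
    · have := φ.isometry.dist_eq z (pt 1 1 one_pos)
      rw [h, hz] at this
      have h3 : reflIso (reflIso (pt 1 1 one_pos)) = pt 1 1 one_pos := reflIso.left_inv _
      rw [hz, fix z (far z ?_)]
      rw [← this, ← reflIso.isometry.dist_eq z, h3]
    · exact hz

end Reflection


/-! ### Classification of the isometries -/

section Isometries

lemma toSL2R_smul_im (p z : ℍ) : (p.toSL2R • z).im = p.im * z.im := by
  have h := Real.sq_sqrt p.im_pos.le
  have h' : √p.im ≠ 0 := (Real.sqrt_pos.2 p.im_pos).ne'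
  rw [sl_im, coe_toSL2R]
  simp only [Matrix.of_apply, Matrix.cons_val', Matrix.cons_val_zero, Matrix.cons_val_one,
    Matrix.cons_val_fin_one]
  field_simp
  rw [h]
  ring

lemma toSL2R_smul_re (p z : ℍ) : (p.toSL2R • z).re = p.im * z.re + p.re := by
  have h := Real.sq_sqrt p.im_pos.le
  have h' : √p.im ≠ 0 := (Real.sqrt_pos.2 p.im_pos).ne'
  rw [sl_re, coe_toSL2R]
  simp only [Matrix.of_apply, Matrix.cons_val', Matrix.cons_val_zero, Matrix.cons_val_one,
    Matrix.cons_val_fin_one]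
  field_simp
  rw [h]
  ring

lemma exists_smul_re_eq_zero (p q : ℍ) : ∃ g : SL(2, ℝ), (g • p).re = 0 ∧ (g • q).re = 0 := by
  by_cases h : p.re = q.re
  · refine ⟨(pt (-p.re) 1 one_pos).toSL2R, ?_, ?_⟩ <;> rw [toSL2R_smul_re] <;> simp [h]
  · have hne : q.re - p.re ≠ 0 := sub_ne_zero.2 (Ne.symm h)
    obtain ⟨c, hc⟩ : ∃ c, (p.re - c) ^ 2 + p.im ^ 2 = (q.re - c) ^ 2 + q.im ^ 2 := by
      refine ⟨(q.re ^ 2 + q.im ^ 2 - p.re ^ 2 - p.im ^ 2) / (2 * (q.re - p.re)), ?_⟩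
      field_simp
      ring
    have hp := p.im_pos
    set r := √((p.re - c) ^ 2 + p.im ^ 2) with hr
    have hr0 : 0 < r := Real.sqrt_pos.2 (by positivity)
    have hrsq : r ^ 2 = (p.re - c) ^ 2 + p.im ^ 2 := Real.sq_sqrt (by positivity)
    have h2r : √(2 * r) ^ 2 = 2 * r := Real.sq_sqrt (by positivity)
    have h2r0 : √(2 * r) ≠ 0 := (Real.sqrt_pos.2 (by positivity)).ne'
    -- Both points lie on the semicircle with centre `c` and radius `r`; this map sends its ends `c
    -- + r` to `0` and `c - r` to `∞`.
    let g : SL(2, ℝ) := ⟨!![1 / √(2 * r), -(c + r) / √(2 * r); 1 / √(2 * r), -(c - r) / √(2 * r)], by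
      rw [Matrix.det_fin_two_of]
      field_simp
      rw [h2r]
      ring⟩
    have key : ∀ z : ℍ, (z.re - c) ^ 2 + z.im ^ 2 = r ^ 2 → (g • z).re = 0 := by
      intro z hz
      rw [sl_re]
      simp only [g, Matrix.of_apply, Matrix.cons_val', Matrix.cons_val_zero, Matrix.cons_val_one,
        Matrix.cons_val_fin_one]
      rw [div_eq_zero_iff]
      left
      field_simp
      linear_combination hz
    exact ⟨g, key p hrsq.symm, key q (hc ▸ hrsq.symm)⟩

lemma exists_smul_eq_I_two_I {p q : ℍ} (h : dist p q = dist I (pt 0 2 two_pos)) :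
    ∃ g : SL(2, ℝ), g • p = I ∧ g • q = pt 0 2 two_pos := by
  obtain ⟨g, hp, hq⟩ := exists_smul_re_eq_zero p q
  have hgp := (g • p).im_pos
  set k : SL(2, ℝ) := (pt 0 ((g • p).im)⁻¹ (by positivity)).toSL2R * g with hk
  have h1 : k • p = I := by
    rw [hk, mul_smul]
    apply UpperHalfPlane.ext_re_im
    · rw [toSL2R_smul_re, hp]
      simp
    · rw [toSL2R_smul_im]
      simp [hgp.ne']
  have h2 : (k • q).re = 0 := by
    rw [hk, mul_smul, toSL2R_smul_re, hq]
    simp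
  have h3 : dist I (k • q) = dist I (pt 0 2 two_pos) := by
    rw [← h, ← h1, dist_smul]
  have e := congrArg Real.cosh h3
  have hpos := (k • q).im_pos
  rw [cosh_dist', cosh_dist', h2] at e
  simp only [pt_re, pt_im, I_re, I_im] at e
  field_simp at e
  have e' : ((k • q).im - 2) * (2 * (k • q).im - 1) = 0 := by linear_combination e
  rcases mul_eq_zero.1 e' with e' | e'
  · refine ⟨k, h1, UpperHalfPlane.ext_re_im h2 ?_⟩
    rw [pt_im]
    linarith
  -- The second point came to `i / 2` instead of `2i`; the inversion `z ↦ -1 / z` fixes `i` and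
  -- exchanges the two.
  · let s : SL(2, ℝ) := ⟨!![0, -1; 1, 0], by simp⟩
    have hs : ∀ z : ℍ, z.re = 0 → (s • z).re = 0 ∧ (s • z).im = 1 / z.im := by
      intro z hz
      have := z.im_pos
      rw [sl_re, sl_im]
      simp only [s, hz, Matrix.of_apply, Matrix.cons_val', Matrix.cons_val_zero,
        Matrix.cons_val_one, Matrix.cons_val_fin_one]
      constructor
      · simp
      · field_simp
        ring
    refine ⟨s * k, ?_, ?_⟩
    · rw [mul_smul, h1]
      apply UpperHalfPlane.ext_re_im
      · rw [(hs I I_re).1, I_re]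
      · rw [(hs I I_re).2, I_im, div_one]
    · rw [mul_smul]
      apply UpperHalfPlane.ext_re_im
      · rw [(hs _ h2).1, pt_re]
      · rw [(hs _ h2).2, pt_im, div_eq_iff hpos.ne']
        linarith

/-- Every isometry of the hyperbolic plane is a Möbius transformation, possibly composed with the
reflection in the imaginary axis. -/
lemma isometry_eq_slIso_or (φ : ℍ ≃ᵢ ℍ) :
    ∃ g : SL(2, ℝ), φ = slIso g ∨ φ = slIso g * reflIso := by
  obtain ⟨g, h1, h2⟩ := exists_smul_eq_I_two_I (φ.isometry.dist_eq I (pt 0 2 two_pos))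
  refine ⟨g⁻¹, ?_⟩
  rcases eq_one_or_eq_refl (φ := slIso g * φ) h1 h2 with h | h
  · left
    rw [map_inv]
    exact eq_inv_of_mul_eq_one_right h
  · right
    rw [map_inv, ← h, inv_mul_cancel_left]

variable {w : ℝ}

/-- The mirror symmetry of the prototile: it allows every tile to be written as an
orientation-preserving copy. -/
lemma refl_image_prototile :
    reflIso '' prototile w = (pt (-w) 1 one_pos).toSL2R • prototile w := by
  ext z
  rw [Set.mem_smul_set_iff_inv_smul_mem]
  have h1 : ((pt (-w) 1 one_pos).toSL2R⁻¹ • z).re = z.re + w ∧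
      ((pt (-w) 1 one_pos).toSL2R⁻¹ • z).im = z.im := by
    have e1 := toSL2R_smul_re (pt (-w) 1 one_pos) ((pt (-w) 1 one_pos).toSL2R⁻¹ • z)
    have e2 := toSL2R_smul_im (pt (-w) 1 one_pos) ((pt (-w) 1 one_pos).toSL2R⁻¹ • z)
    rw [smul_inv_smul] at e1 e2
    simp only [pt_re, pt_im] at e1 e2
    constructor <;> linarith
  constructor
  · rintro ⟨y, ⟨a, b, c, d⟩, rfl⟩
    rw [reflIso_re, reflIso_im] at h1
    refine ⟨?_, ?_, ?_, ?_⟩ <;> linarith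
  · rintro ⟨a, b, c, d⟩
    refine ⟨reflIso z, ⟨?_, ?_, ?_, ?_⟩, reflIso.left_inv z⟩ <;> simp only [reflIso_re, reflIso_im] <;>
      linarith

lemma isTile_iff_exists_smul {T : Set ℍ} : IsTile w T ↔ ∃ g : SL(2, ℝ), T = g • prototile w := by
  constructor
  · rintro ⟨φ, rfl⟩
    obtain ⟨g, rfl | rfl⟩ := isometry_eq_slIso_or φ
    · exact ⟨g, rfl⟩
    · refine ⟨g * (pt (-w) 1 one_pos).toSL2R, ?_⟩
      rw [mul_smul, ← refl_image_prototile]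
      exact Set.image_comp (slIso g) reflIso _
  · rintro ⟨g, rfl⟩
    exact ⟨slIso g, rfl⟩

end Isometries


/-! ### Local finiteness of tilings -/

section LocalFiniteness

variable {w : ℝ} {𝒯 : Set (Set ℍ)}

lemma isBounded_prototile : Bornology.IsBounded (prototile w) := by
  have hc : Continuous fun p : ℝ × ℝ => pt p.1 (max p.2 1) (lt_max_of_lt_right one_pos) :=
    continuous_pt_comp (by fun_prop) (by fun_prop) _
  refine (((isCompact_Icc (a := (0 : ℝ)) (b := w)).prod
    (isCompact_Icc (a := (1 : ℝ)) (b := 2))).image hc).isBounded.subset ?_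
  rintro z ⟨a, b, c, d⟩
  refine ⟨(z.re, z.im), ⟨⟨a, b⟩, ⟨c, d⟩⟩, ?_⟩
  apply UpperHalfPlane.ext_re_im <;> simp [c]

lemma IsBTiling.exists_smul (h𝒯 : IsBTiling w 𝒯) {T : Set ℍ} (hT : T ∈ 𝒯) :
    ∃ g : SL(2, ℝ), T = g • prototile w :=
  isTile_iff_exists_smul.1 (h𝒯.isTile T hT)

/-- A tiling is locally finite. -/
lemma IsBTiling.finite_meeting_ball (hw : 0 < w) (h𝒯 : IsBTiling w 𝒯) (q : ℍ) :
    {T ∈ 𝒯 | (T ∩ Metric.closedBall q 1).Nonempty}.Finite := by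
  classical
  set o : ℍ := pt (w / 2) (3 / 2) (by norm_num) with ho
  have hoi : o ∈ interior (prototile w) := by
    rw [mem_interior_prototile, ho, pt_re, pt_im]
    refine ⟨?_, ?_, ?_, ?_⟩ <;> linarith
  obtain ⟨r, hr, hball⟩ := Metric.isOpen_iff.1 isOpen_interior o hoi
  obtain ⟨R, hR⟩ := (isBounded_prototile (w := w)).subset_closedBall o
  have hchoice : ∀ T : Set ℍ, ∃ g : SL(2, ℝ), T ∈ 𝒯 → T = g • prototile w := by
    intro T
    by_cases hT : T ∈ 𝒯
    · obtain ⟨g, hg⟩ := h𝒯.exists_smul hT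
      exact ⟨g, fun _ => hg⟩
    · exact ⟨1, fun h => (hT h).elim⟩
  choose g hg using hchoice
  have hin : ∀ T ∈ 𝒯, interior T = g T • interior (prototile w) := fun T hT =>
    (congrArg interior (hg T hT)).trans (interior_smul _ _)
  -- The `r`-ball about the centre of a tile lies in its interior, so centres of different tiles are
  -- at least `r` apart.
  have hfar : ∀ T ∈ 𝒯, ∀ T' ∈ 𝒯, dist (g T • o) (g T' • o) < r → T = T' := by
    intro T hT T' hT' hd
    by_contra hne
    refine Set.disjoint_left.1 (h𝒯.nonoverlapping T hT T' hT' hne)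
      (?_ : g T • o ∈ interior T) ?_
    · rw [hin T hT]
      exact Set.smul_mem_smul_set hoi
    · rw [hin T' hT', Set.mem_smul_set_iff_inv_smul_mem]
      apply hball
      rw [Metric.mem_ball, ← dist_smul (g T'), smul_inv_smul]
      exact hd
  have htb : TotallyBounded (Metric.closedBall q (1 + R)) :=
    -- Tiles meeting the unit ball have centres in a compact ball, which has a finite `r / 2`-net; a
    -- point of the net is within `r / 2` of at most one centre.
    (isCompact_closedBall q (1 + R)).totallyBounded
  obtain ⟨t, ht, htc⟩ := Metric.totallyBounded_iff.1 htb (r / 2) (by positivity)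
  have hnear : ∀ T ∈ {T ∈ 𝒯 | (T ∩ Metric.closedBall q 1).Nonempty},
      ∃ y ∈ t, dist (g T • o) y < r / 2 := by
    rintro T ⟨hT, z, hz, hzq⟩
    rw [hg T hT] at hz
    obtain ⟨u, hu, rfl⟩ := hz
    have h1 : dist u o ≤ R := hR hu
    have h2 : g T • o ∈ Metric.closedBall q (1 + R) := by
      have h3 : dist (g T • u) q ≤ 1 := hzq
      have h4 := dist_triangle (g T • o) (g T • u) q
      rw [dist_smul, dist_comm o] at h4
      rw [Metric.mem_closedBall]
      linarith
    simpa using htc h2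
  choose! y hy hyd using hnear
  refine Set.Finite.of_injOn (f := y) (t := t) (fun T hT => hy T hT) ?_ ht
  intro T hT T' hT' e
  apply hfar T hT.1 T' hT'.1
  have h1 := hyd T hT
  have h2 := hyd T' hT'
  rw [← e, dist_comm] at h2
  linarith [dist_triangle (g T • o) (y T) (g T' • o)]

/-- A boundary point of a tile lies in another tile. -/
lemma IsBTiling.exists_ne_mem (hw : 0 < w) (h𝒯 : IsBTiling w 𝒯) {T : Set ℍ} {q : ℍ}
    (hq : q ∉ interior T) : ∃ T' ∈ 𝒯, T' ≠ T ∧ q ∈ T' := by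
  by_contra! hne
  apply hq
  have hfin : {T' ∈ 𝒯 | (T' ∩ Metric.closedBall q 1).Nonempty ∧ T' ≠ T}.Finite :=
    (h𝒯.finite_meeting_ball hw q).subset fun T' h => ⟨h.1, h.2.1⟩
  -- If no other tile contained `q`, removing this closed finite union from the unit ball would
  -- leave a neighbourhood of `q` covered by `T` alone.
  have hclosed : IsClosed (⋃ T' ∈ {T' ∈ 𝒯 | (T' ∩ Metric.closedBall q 1).Nonempty ∧ T' ≠ T}, T') := by
    refine hfin.isClosed_biUnion fun T' hT' => ?_
    obtain ⟨g, rfl⟩ := h𝒯.exists_smul hT'.1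
    exact isClosed_prototile.smul g
  rw [mem_interior]
  refine ⟨Metric.ball q 1 ∩ (⋃ T' ∈ {T' ∈ 𝒯 | (T' ∩ Metric.closedBall q 1).Nonempty ∧ T' ≠ T},
    T')ᶜ, ?_, Metric.isOpen_ball.inter hclosed.isOpen_compl, ?_⟩
  · rintro z ⟨hz, hz'⟩
    have : z ∈ ⋃₀ 𝒯 := by
      rw [h𝒯.covers]
      trivial
    obtain ⟨T', hT', hzT'⟩ := this
    by_cases h : T' = T
    · exact h ▸ hzT'
    · exact (hz' (Set.mem_biUnion (x := T')
        ⟨hT', ⟨z, hzT', Metric.ball_subset_closedBall hz⟩, h⟩ hzT')).elim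
  · refine ⟨Metric.mem_ball_self one_pos, ?_⟩
    simp only [Set.mem_compl_iff, Set.mem_iUnion, not_exists]
    rintro T' ⟨hT', -, h⟩ hq'
    exact hne T' hT' h hq'

end LocalFiniteness

/-! ### The tile behind an edge -/

section Neighbours

variable {w : ℝ} {𝒯 : Set (Set ℍ)}

/-- The affine map `z ↦ 2 ^ k z + t`. -/
def aff (k : ℤ) (t : ℝ) : SL(2, ℝ) := (pt t (2 ^ k) (by positivity)).toSL2R

@[simp] lemma aff_smul_re (k : ℤ) (t : ℝ) (z : ℍ) : (aff k t • z).re = 2 ^ k * z.re + t :=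
  toSL2R_smul_re _ _

@[simp] lemma aff_smul_im (k : ℤ) (t : ℝ) (z : ℍ) : (aff k t • z).im = 2 ^ k * z.im :=
  toSL2R_smul_im _ _

lemma aff_smul_aff_smul (k m : ℤ) (t u : ℝ) (z : ℍ) :
    aff k t • aff m u • z = aff (k + m) (2 ^ k * u + t) • z := by
  apply UpperHalfPlane.ext_re_im
  · simp only [aff_smul_re, zpow_add₀ (two_ne_zero' ℝ)]
    ring
  · simp only [aff_smul_im, zpow_add₀ (two_ne_zero' ℝ)]
    ring

lemma aff_smul_aff_smul_set (k m : ℤ) (t u : ℝ) (S : Set ℍ) :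
    aff k t • aff m u • S = aff (k + m) (2 ^ k * u + t) • S := by
  rw [smul_smul]
  refine Set.image_congr fun z _ => ?_
  change (aff k t * aff m u) • z = _
  rw [mul_smul, aff_smul_aff_smul]

lemma aff_inv_smul (k : ℤ) (t : ℝ) (z : ℍ) :
    (aff k t)⁻¹ • z = aff (-k) (-(2 ^ (-k) * t)) • z := by
  rw [inv_smul_eq_iff, aff_smul_aff_smul]
  apply UpperHalfPlane.ext_re_im
  · simp only [aff_smul_re, add_neg_cancel, zpow_zero, zpow_neg]
    field_simp
    ring
  · simp

lemma smul_set_eq_of_affine (g : SL(2, ℝ)) (k : ℤ) (β : ℝ)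
    (h : ∀ z : ℍ, (g • z).re = 2 ^ k * z.re + β ∧ (g • z).im = 2 ^ k * z.im) (S : Set ℍ) :
    g • S = aff k β • S := by
  refine Set.image_congr fun z _ => ?_
  apply UpperHalfPlane.ext_re_im
  · exact (h z).1.trans (aff_smul_re _ _ _).symm
  · exact (h z).2.trans (aff_smul_im _ _ _).symm

lemma IsBTiling.eq_of_interior (h𝒯 : IsBTiling w 𝒯) {T T' : Set ℍ} (hT : T ∈ 𝒯) (hT' : T' ∈ 𝒯)
    {z : ℍ} (hz : z ∈ interior T) (hz' : z ∈ interior T') : T = T' := by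
  by_contra hne
  exact Set.disjoint_left.1 (h𝒯.nonoverlapping T hT T' hT' hne) hz hz'

/-- The tile behind an edge: if `q` lies on the edge `j` only and is not a vertex, some other
tile has this edge in common with the given one. -/
lemma IsBTiling.exists_neighbour (hw : 0 < w) (h𝒯 : IsBTiling w 𝒯) {h : SL(2, ℝ)}
    (hh : h • prototile w ∈ 𝒯) {j : EdgeName} {q : ℍ} (hq : q ∈ protoEdge w j)
    (hj : ∀ k, q ∈ protoEdge w k → k = j) (hv : q ∉ protoVertices w) :
    ∃ (f : SL(2, ℝ)) (k : EdgeName), (h * f) • prototile w ∈ 𝒯 ∧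
      f • prototile w ≠ prototile w ∧ f • protoEdge w k = protoEdge w j := by
  have hint : h • q ∉ interior (h • prototile w) := by
    rw [interior_smul, Set.smul_mem_smul_set_iff]
    exact protoEdge_notMem_interior hq
  obtain ⟨T', hT', hne, hqT'⟩ := h𝒯.exists_ne_mem hw hint
  have hqT : h • q ∈ h • prototile w := Set.smul_mem_smul_set (protoEdge_subset hw _ hq)
  obtain ⟨g, rfl⟩ := h𝒯.exists_smul hT'
  rcases h𝒯.edgeToEdge _ hh _ hT' hne.symm ⟨_, hqT, hqT'⟩ with ⟨k, k', hk, hk'⟩ | ⟨v, hv', hv1, -⟩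
  · rw [isEdge_smul_iff hw] at hk hk'
    have hqk : h • q ∈ h • protoEdge w k := hk ▸ ⟨hqT, hqT'⟩
    rw [Set.smul_mem_smul_set_iff] at hqk
    obtain rfl := hj k hqk
    refine ⟨h⁻¹ * g, k', ?_, ?_, ?_⟩
    · rwa [mul_inv_cancel_left]
    · rw [mul_smul, Ne, inv_smul_eq_iff]
      exact hne
    · rw [mul_smul, ← hk', hk, inv_smul_smul]
  · have : h • q ∈ ({v} : Set ℍ) := hv' ▸ ⟨hqT, hqT'⟩
    rw [Set.mem_singleton_iff] at this
    rw [← this, isVertex_smul_iff hw, inv_smul_smul] at hv1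
    exact (hv hv1).elim

/-- Two tiles of a tiling whose interiors share a point of the form `h • z` are equal. -/
lemma IsBTiling.smul_prototile_eq (h𝒯 : IsBTiling w 𝒯) {h f : SL(2, ℝ)}
    (hh : h • prototile w ∈ 𝒯) (hf : (h * f) • prototile w ∈ 𝒯) {z : ℍ}
    (hz : z ∈ interior (prototile w)) (hz' : f • z ∈ interior (prototile w)) :
    f • prototile w = prototile w := by
  have : (h * f) • prototile w = h • prototile w := by
    refine h𝒯.eq_of_interior hf hh (z := h • f • z) ?_ ?_
    · rw [interior_smul, mul_smul, Set.smul_mem_smul_set_iff, Set.smul_mem_smul_set_iff]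
      exact hz
    · rw [interior_smul, Set.smul_mem_smul_set_iff]
      exact hz'
  rw [mul_smul] at this
  exact MulAction.injective h this

/-- If a Möbius transformation moves an edge of the prototile to a horocyclic edge, the edge is
horocyclic and `∞` is fixed. -/
lemma lower_left_eq_zero_of_edge (hw : 0 < w) {f : SL(2, ℝ)} {j k : EdgeName}
    (hj : j = .a ∨ j = .b₁ ∨ j = .b₂) (h : f • protoEdge w k = protoEdge w j) :
    (k = .a ∨ k = .b₁ ∨ k = .b₂) ∧ f 1 0 = 0 := by
  have hinf : (protoEdge w j).Infinite ∧ ∃ y, 0 < y ∧ ∀ z ∈ protoEdge w j, z.im = y := by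
    rcases hj with rfl | rfl | rfl
    · exact ⟨infinite_horizontal hw two_pos, 2, two_pos, fun z hz => hz.2.2⟩
    · exact ⟨infinite_horizontal (by positivity) one_pos, 1, one_pos, fun z hz => hz.2.2⟩
    · exact ⟨infinite_horizontal (by linarith) one_pos, 1, one_pos, fun z hz => hz.2.2⟩
  obtain ⟨hinf, y, hy0, hy⟩ := hinf
  have hinfk : (protoEdge w k).Infinite := by
    rw [← h] at hinf
    exact Set.Infinite.of_image _ hinf
  have him : ∀ z ∈ protoEdge w k, (f • z).im = y := fun z hz =>
    hy _ (h ▸ Set.smul_mem_smul_set hz)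
  have hinv : ∀ z ∈ protoEdge w j, f⁻¹ • z ∈ protoEdge w k := fun z hz => by
    rw [← h] at hz
    exact Set.mem_smul_set_iff_inv_smul_mem.1 hz
  cases k
  · exact ⟨by simp, lower_left_eq_zero_of_horizontal hy0 hinfk (fun z hz => hz.2.2) him⟩
  · exact ⟨by simp, lower_left_eq_zero_of_horizontal hy0 hinfk (fun z hz => hz.2.2) him⟩
  · exact ⟨by simp, lower_left_eq_zero_of_horizontal hy0 hinfk (fun z hz => hz.2.2) him⟩
  · exact (not_horizontal_to_vertical hinf hy fun z hz => (hinv z hz).1).elim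
  · exact (not_horizontal_to_vertical hinf hy fun z hz => (hinv z hz).1).elim

/-- An affine map moving one horizontal segment onto another moves the end points correctly. -/
lemma affine_horizontal {f : SL(2, ℝ)} {α β a b y a' b' y' : ℝ} (hα : 0 < α)
    (hf : ∀ z : ℍ, (f • z).re = α * z.re + β ∧ (f • z).im = α * z.im)
    (hab : a < b) (hab' : a' < b') (hy : 0 < y) (hy' : 0 < y')
    (h : f • {z : ℍ | a ≤ z.re ∧ z.re ≤ b ∧ z.im = y} =
      {z : ℍ | a' ≤ z.re ∧ z.re ≤ b' ∧ z.im = y'}) :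
    α * a + β = a' ∧ α * b + β = b' ∧ α * y = y' := by
  have h1 : ∀ x, a ≤ x → x ≤ b → a' ≤ α * x + β ∧ α * x + β ≤ b' ∧ α * y = y' := by
    intro x hx hx'
    have hm : pt x y hy ∈ {z : ℍ | a ≤ z.re ∧ z.re ≤ b ∧ z.im = y} := ⟨hx, hx', rfl⟩
    have := Set.smul_mem_smul_set (a := f) hm
    rw [h] at this
    obtain ⟨e1, e2⟩ := hf (pt x y hy)
    rw [pt_re] at e1
    rw [pt_im] at e2
    rw [← e1, ← e2]
    exact this
  have h2 : ∀ x', a' ≤ x' → x' ≤ b' → ∃ x, a ≤ x ∧ x ≤ b ∧ x' = α * x + β := by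
    intro x' hx hx'
    have hm : pt x' y' hy' ∈ {z : ℍ | a' ≤ z.re ∧ z.re ≤ b' ∧ z.im = y'} := ⟨hx, hx', rfl⟩
    rw [← h] at hm
    obtain ⟨z, hz, e⟩ := hm
    have e' : f • z = pt x' y' hy' := e
    refine ⟨z.re, hz.1, hz.2.1, ?_⟩
    rw [← (hf z).1, e', pt_re]
  obtain ⟨p1, p2, p3⟩ := h1 a le_rfl hab.le
  obtain ⟨q1, q2, q3⟩ := h1 b hab.le le_rfl
  obtain ⟨x, x1, x2, x3⟩ := h2 a' le_rfl hab'.le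
  obtain ⟨y, y1, y2, y3⟩ := h2 b' hab'.le le_rfl
  refine ⟨?_, ?_, p3⟩ <;> nlinarith

end Neighbours


/-! ### Positions of the neighbours of a tile -/

section NeighbourPositions

variable {w : ℝ} {𝒯 : Set (Set ℍ)}

/-- The end points of the horocyclic edges and their height. -/
lemma exists_protoEdge_eq (hw : 0 < w) {k : EdgeName} (hk : k = .a ∨ k = .b₁ ∨ k = .b₂) :
    ∃ a b y : ℝ, a < b ∧ 0 < y ∧ protoEdge w k = {z | a ≤ z.re ∧ z.re ≤ b ∧ z.im = y} ∧
      ((k = .a ∧ a = 0 ∧ b = w ∧ y = 2) ∨ (k = .b₁ ∧ a = 0 ∧ b = w / 2 ∧ y = 1) ∨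
        (k = .b₂ ∧ a = w / 2 ∧ b = w ∧ y = 1)) := by
  rcases hk with rfl | rfl | rfl
  · exact ⟨0, w, 2, hw, two_pos, rfl, by simp⟩
  · exact ⟨0, w / 2, 1, by positivity, one_pos, rfl, by simp⟩
  · exact ⟨w / 2, w, 1, by linarith, one_pos, rfl, by simp⟩

/-- A Möbius transformation moving an edge of the prototile to a horocyclic edge is an affine map
determined by the names of the edges. -/
lemma affine_of_edge (hw : 0 < w) {f : SL(2, ℝ)} {j k : EdgeName}
    (hj : j = .a ∨ j = .b₁ ∨ j = .b₂) (h : f • protoEdge w k = protoEdge w j) :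
    ∃ α β : ℝ, (∀ z : ℍ, (f • z).re = α * z.re + β ∧ (f • z).im = α * z.im) ∧
      ((j = k ∧ α = 1 ∧ β = 0) ∨ (j = .a ∧ k = .b₁ ∧ α = 2 ∧ β = 0) ∨
       (j = .a ∧ k = .b₂ ∧ α = 2 ∧ β = -w) ∨ (j = .b₁ ∧ k = .a ∧ α = 1 / 2 ∧ β = 0) ∨
       (j = .b₂ ∧ k = .a ∧ α = 1 / 2 ∧ β = w / 2) ∨ (j = .b₁ ∧ k = .b₂ ∧ α = 1 ∧ β = -(w / 2)) ∨
       (j = .b₂ ∧ k = .b₁ ∧ α = 1 ∧ β = w / 2)) := by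
  obtain ⟨hk, hc⟩ := lower_left_eq_zero_of_edge hw hj h
  obtain ⟨α, β, hα, hf⟩ := affine_of_lower_left_eq_zero hc
  refine ⟨α, β, hf, ?_⟩
  obtain ⟨a, b, y, hab, hy, e, hcase⟩ := exists_protoEdge_eq hw hk
  obtain ⟨a', b', y', hab', hy', e', hcase'⟩ := exists_protoEdge_eq hw hj
  rw [e, e'] at h
  obtain ⟨h1, h2, h3⟩ := affine_horizontal hα hf hab hab' hy hy' h
  have hwne := hw.ne'
  rcases hcase with ⟨rfl, rfl, rfl, rfl⟩ | ⟨rfl, rfl, rfl, rfl⟩ | ⟨rfl, rfl, rfl, rfl⟩ <;>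
    rcases hcase' with ⟨rfl, rfl, rfl, rfl⟩ | ⟨rfl, rfl, rfl, rfl⟩ | ⟨rfl, rfl, rfl, rfl⟩ <;>
    simp only [reduceCtorEq, true_and, false_and, or_false, false_or] <;>
    constructor <;> nlinarith

lemma aff_zero_zero_smul (S : Set ℍ) : aff 0 0 • S = S := by
  have : ∀ z : ℍ, aff 0 0 • z = z := fun z => by apply UpperHalfPlane.ext_re_im <;> simp
  ext z
  rw [Set.mem_smul_set]
  simp [this]

/-- Across the `a`-edge the matching edge can be `a`, which gives the tile itself, or `b₁` or `b₂`,
which give the two doubled copies. Here "up" means larger imaginary part, the direction that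
`StepDown` calls down. -/
lemma IsBTiling.up (hw : 0 < w) (h𝒯 : IsBTiling w 𝒯) {h : SL(2, ℝ)}
    (hh : h • prototile w ∈ 𝒯) :
    h • aff 1 0 • prototile w ∈ 𝒯 ∨ h • aff 1 (-w) • prototile w ∈ 𝒯 := by
  obtain ⟨f, k, hf, hne, hfk⟩ := h𝒯.exists_neighbour hw hh (j := .a)
    (q := pt (w / 2) 2 two_pos) ⟨by simp only [pt_re]; linarith, by simp only [pt_re]; linarith, rfl⟩ (by
      intro k hk
      cases k <;> simp [protoEdge] at hk ⊢ <;> linarith) (by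
      rintro (⟨-, h⟩ | ⟨h, -⟩)
      · simp only [pt_re] at h
        rcases h with h | h <;> linarith
      · simp at h)
  rw [mul_smul] at hf
  obtain ⟨α, β, hfα, hcase⟩ := affine_of_edge hw (by simp) hfk
  simp only [true_and, reduceCtorEq, false_and, or_false] at hcase
  rcases hcase with ⟨-, rfl, rfl⟩ | ⟨-, rfl, rfl⟩ | ⟨-, rfl, rfl⟩
  · refine (hne ?_).elim
    rw [smul_set_eq_of_affine f 0 0 (by simpa using hfα), aff_zero_zero_smul]
  · left
    rwa [smul_set_eq_of_affine f 1 0 (by simpa using hfα)] at hf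
  · right
    rwa [smul_set_eq_of_affine f 1 (-w) (by simpa using hfα)] at hf

/-- Matching `b₁` with `b₂` would shift the tile by half its width, so the interiors would overlap;
only the `a`-edge of a halved copy remains. -/
lemma IsBTiling.down (hw : 0 < w) (h𝒯 : IsBTiling w 𝒯) {h : SL(2, ℝ)}
    (hh : h • prototile w ∈ 𝒯) :
    h • aff (-1) 0 • prototile w ∈ 𝒯 ∧ h • aff (-1) (w / 2) • prototile w ∈ 𝒯 := by
  constructor
  · obtain ⟨f, k, hf, hne, hfk⟩ := h𝒯.exists_neighbour hw hh (j := .b₁)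
      (q := pt (w / 4) 1 one_pos) ⟨by simp only [pt_re]; linarith, by simp only [pt_re]; linarith, rfl⟩ (by
        intro k hk
        cases k <;> simp [protoEdge] at hk ⊢ <;> linarith) (by
        rintro (⟨h, -⟩ | ⟨-, h⟩)
        · simp at h
        · simp only [pt_re] at h
          rcases h with h | h | h <;> linarith)
    obtain ⟨α, β, hfα, hcase⟩ := affine_of_edge hw (by simp) hfk
    simp only [true_and, reduceCtorEq, false_and, or_false, false_or] at hcase
    rcases hcase with ⟨-, rfl, rfl⟩ | ⟨-, rfl, rfl⟩ | ⟨-, rfl, rfl⟩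
    · refine (hne ?_).elim
      rw [smul_set_eq_of_affine f 0 0 (by simpa using hfα), aff_zero_zero_smul]
    · rwa [mul_smul, smul_set_eq_of_affine f (-1) 0 (by simpa using hfα)] at hf
    · refine (hne (h𝒯.smul_prototile_eq hh hf (z := pt (3 * w / 4) (3 / 2) (by norm_num)) ?_ ?_)).elim
      · rw [mem_interior_prototile]
        refine ⟨?_, ?_, ?_, ?_⟩ <;> simp only [pt_re, pt_im] <;> linarith
      · rw [mem_interior_prototile, (hfα _).1, (hfα _).2]
        refine ⟨?_, ?_, ?_, ?_⟩ <;> simp only [pt_re, pt_im] <;> linarith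
  · obtain ⟨f, k, hf, hne, hfk⟩ := h𝒯.exists_neighbour hw hh (j := .b₂)
      (q := pt (3 * w / 4) 1 one_pos)
      ⟨by simp only [pt_re]; linarith, by simp only [pt_re]; linarith, rfl⟩ (by
        intro k hk
        cases k <;> simp [protoEdge] at hk ⊢ <;> linarith) (by
        rintro (⟨h, -⟩ | ⟨-, h⟩)
        · simp at h
        · simp only [pt_re] at h
          rcases h with h | h | h <;> linarith)
    obtain ⟨α, β, hfα, hcase⟩ := affine_of_edge hw (by simp) hfk
    simp only [true_and, reduceCtorEq, false_and, false_or] at hcase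
    rcases hcase with ⟨-, rfl, rfl⟩ | ⟨-, rfl, rfl⟩ | ⟨-, rfl, rfl⟩
    · refine (hne ?_).elim
      rw [smul_set_eq_of_affine f 0 0 (by simpa using hfα), aff_zero_zero_smul]
    · rwa [mul_smul, smul_set_eq_of_affine f (-1) (w / 2) (by simpa using hfα)] at hf
    · refine (hne (h𝒯.smul_prototile_eq hh hf (z := pt (w / 4) (3 / 2) (by norm_num)) ?_ ?_)).elim
      · rw [mem_interior_prototile]
        refine ⟨?_, ?_, ?_, ?_⟩ <;> simp only [pt_re, pt_im] <;> linarith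
      · rw [mem_interior_prototile, (hfα _).1, (hfα _).2]
        refine ⟨?_, ?_, ?_, ?_⟩ <;> simp only [pt_re, pt_im] <;> linarith

/-- A Möbius transformation moving a vertical edge to a vertical edge and its upper end point to
the upper end point is a translation. -/
lemma translation_of_vertical {f : SL(2, ℝ)} {x x' : ℝ}
    (hf : f • {z : ℍ | z.re = x ∧ 1 ≤ z.im ∧ z.im ≤ 2} = {z | z.re = x' ∧ 1 ≤ z.im ∧ z.im ≤ 2})
    (htop : f • pt x 2 two_pos = pt x' 2 two_pos) (z : ℍ) :
    (f • z).re = z.re + (x' - x) ∧ (f • z).im = z.im := by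
  have hmem : ∀ z : ℍ, z.re = x → 1 ≤ z.im → z.im ≤ 2 →
      (f • z).re = x' ∧ 1 ≤ (f • z).im ∧ (f • z).im ≤ 2 := by
    intro z h1 h2 h3
    have := Set.smul_mem_smul_set (a := f) (show z ∈ {z : ℍ | z.re = x ∧ 1 ≤ z.im ∧ z.im ≤ 2}
      from ⟨h1, h2, h3⟩)
    rwa [hf] at this
  have him := congrArg UpperHalfPlane.im htop
  have hre := congrArg UpperHalfPlane.re htop
  rcases vertical_to_vertical fun z h1 h2 h3 => (hmem z h1 h2 h3).1 with hc | hc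
  · obtain ⟨α, β, hα, h⟩ := affine_of_lower_left_eq_zero hc
    rw [(h _).2] at him
    rw [(h _).1] at hre
    simp only [pt_re, pt_im] at him hre
    have hα1 : α = 1 := by linarith
    subst hα1
    have hβ : β = x' - x := by linarith
    rw [(h z).1, (h z).2, hβ]
    simp
  -- Here the end point `x` goes to `∞`, so the edge is turned round; with the upper end kept at
  -- height `2`, the lower end would go to height `4`.
  · exfalso
    have h1 := (hmem (pt x 1 one_pos) rfl le_rfl one_le_two).2.2
    have hne := denom_sq_pos f (pt x 1 one_pos)
    rw [sl_im] at him h1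
    simp only [pt_re, pt_im, hc] at him h1 hne
    have hc0 : f 1 0 ≠ 0 := by
      rintro h
      simp [h] at hne
    have h4 : f 1 0 ^ 2 = 1 / 4 := by
      field_simp at him
      linarith
    rw [mul_one, h4] at h1
    norm_num at h1

lemma mem_inter_of_vertical (hw : 0 < w) :
    protoEdge w .cLeft ∩ protoEdge w .a = {pt 0 2 two_pos} ∧
      protoEdge w .cRight ∩ protoEdge w .a = {pt w 2 two_pos} := by
  constructor
  · ext z
    simp only [protoEdge, Set.mem_inter_iff, Set.mem_ofPred_eq, Set.mem_singleton_iff]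
    constructor
    · rintro ⟨⟨h, -⟩, -, -, h'⟩
      exact UpperHalfPlane.ext_re_im h h'
    · rintro rfl
      simp [hw.le]
  · ext z
    simp only [protoEdge, Set.mem_inter_iff, Set.mem_ofPred_eq, Set.mem_singleton_iff]
    constructor
    · rintro ⟨⟨h, -⟩, -, -, h'⟩
      exact UpperHalfPlane.ext_re_im h h'
    · rintro rfl
      simp [hw.le]

/-- The tile behind a straight edge is a translate along the horocycles. -/
lemma IsBTiling.translation_of_vertical_edge (hw : 0 < w) (h𝒯 : IsBTiling w 𝒯)
    {h f : SL(2, ℝ)} (hh : h • prototile w ∈ 𝒯) (hf : (h * f) • prototile w ∈ 𝒯)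
    {j k : EdgeName} (hj : j = .cLeft ∨ j = .cRight) (hfk : f • protoEdge w k = protoEdge w j) :
    (k = .cLeft ∨ k = .cRight) ∧ ∀ x x' : ℝ, (k = .cLeft → x = 0) → (k = .cRight → x = w) →
      (j = .cLeft → x' = 0) → (j = .cRight → x' = w) →
      ∀ z : ℍ, (f • z).re = z.re + (x' - x) ∧ (f • z).im = z.im := by
  have hk : k = .cLeft ∨ k = .cRight := by
    by_contra hk
    have hk' : k = .a ∨ k = .b₁ ∨ k = .b₂ := by
      cases k <;> simp_all
    have := lower_left_eq_zero_of_edge hw (f := f⁻¹) hk' (by rw [← hfk, inv_smul_smul])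
    rcases hj with rfl | rfl <;> simp at this
  refine ⟨hk, fun x x' h1 h2 h3 h4 => ?_⟩
  -- The orientation condition says that the shared `c`-edge meets both `a`-edges in the same point,
  -- so `f` takes upper end to upper end.
  have hor := h𝒯.oriented _ hh _ hf (h • protoEdge w j) (h • protoEdge w .a)
    ((h * f) • protoEdge w .a)
    (by
      unfold IsCEdge
      rw [isEdge_smul_iff hw, isEdge_smul_iff hw]
      rcases hj with rfl | rfl <;> simp)
    (by
      unfold IsCEdge
      rw [isEdge_smul_iff hw, isEdge_smul_iff hw, ← hfk, mul_smul, mul_smul]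
      rcases hk with rfl | rfl <;> simp)
    ((isEdge_smul_iff hw).2 rfl) ((isEdge_smul_iff hw).2 rfl)
  rw [mul_smul, ← Set.smul_set_inter, ← Set.smul_set_inter] at hor
  have hor' := MulAction.injective h hor
  rw [← hfk, ← Set.smul_set_inter, hfk] at hor'
  obtain ⟨e1, e2⟩ := mem_inter_of_vertical hw
  apply translation_of_vertical
  · rcases hj with rfl | rfl <;> rcases hk with rfl | rfl <;>
      simp only [h1, h2, h3, h4] <;> exact hfk
  · rcases hj with rfl | rfl <;> rcases hk with rfl | rfl <;>
      simp only [h1, h2, h3, h4, e1, e2, Set.smul_set_singleton, Set.singleton_eq_singleton_iff]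
        at hor' ⊢ <;> exact hor'.symm

lemma IsBTiling.side (hw : 0 < w) (h𝒯 : IsBTiling w 𝒯) {h : SL(2, ℝ)}
    (hh : h • prototile w ∈ 𝒯) :
    h • aff 0 (-w) • prototile w ∈ 𝒯 ∧ h • aff 0 w • prototile w ∈ 𝒯 := by
  constructor
  · obtain ⟨f, k, hf, hne, hfk⟩ := h𝒯.exists_neighbour hw hh (j := .cLeft)
      (q := pt 0 (3 / 2) (by norm_num)) ⟨rfl, by norm_num, by norm_num⟩ (by
        intro k hk
        cases k <;> simp [protoEdge] at hk ⊢ <;> linarith) (by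
        rintro (⟨h, -⟩ | ⟨h, -⟩) <;> norm_num at h)
    obtain ⟨hk, h1⟩ := h𝒯.translation_of_vertical_edge hw hh hf (by simp) hfk
    rw [mul_smul] at hf
    rcases hk with rfl | rfl
    · have := h1 0 0 (by simp) (by simp) (by simp) (by simp)
      refine (hne ?_).elim
      rw [smul_set_eq_of_affine f 0 0 (by simpa using this), aff_zero_zero_smul]
    · have := h1 w 0 (by simp) (by simp) (by simp) (by simp)
      rwa [smul_set_eq_of_affine f 0 (-w) (by simpa using this)] at hf
  · obtain ⟨f, k, hf, hne, hfk⟩ := h𝒯.exists_neighbour hw hh (j := .cRight)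
      (q := pt w (3 / 2) (by norm_num)) ⟨rfl, by norm_num, by norm_num⟩ (by
        intro k hk
        cases k <;> simp [protoEdge] at hk ⊢ <;> linarith) (by
        rintro (⟨h, -⟩ | ⟨h, -⟩) <;> norm_num at h)
    obtain ⟨hk, h1⟩ := h𝒯.translation_of_vertical_edge hw hh hf (by simp) hfk
    rw [mul_smul] at hf
    rcases hk with rfl | rfl
    · have := h1 0 w (by simp) (by simp) (by simp) (by simp)
      rwa [smul_set_eq_of_affine f 0 w (by simpa using this)] at hf
    · have := h1 w w (by simp) (by simp) (by simp) (by simp)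
      refine (hne ?_).elim
      rw [smul_set_eq_of_affine f 0 0 (by simpa using this), aff_zero_zero_smul]

end NeighbourPositions


/-! ### Every tiling comes from a nested family of cosets -/

section Structure

variable {w : ℝ}

/-- The upright tile of level `k` with left side on `re = t`. -/
def upright (w : ℝ) (k : ℤ) (t : ℝ) : Set ℍ := aff k t • prototile w

/-- A nested family of cosets of the groups `2 ^ k w ℤ`. -/
structure IsGrid (w : ℝ) (L : ℤ → Set ℝ) : Prop where
  nonempty : ∀ k, (L k).Nonempty
  add_mem : ∀ k, ∀ t ∈ L k, ∀ n : ℤ, t + 2 ^ k * w * n ∈ L k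
  exists_eq : ∀ k, ∀ t ∈ L k, ∀ u ∈ L k, ∃ n : ℤ, u = t + 2 ^ k * w * n
  succ_subset : ∀ k, L (k + 1) ⊆ L k

/-- The tiling given by a nested family of cosets. -/
def gridTiling (w : ℝ) (L : ℤ → Set ℝ) : Set (Set ℍ) :=
  {T | ∃ k, ∃ t ∈ L k, T = upright w k t}

lemma exists_int_mul_mem {p : ℝ} (hp : 0 < p) (t x : ℝ) :
    ∃ n : ℤ, t + p * n ≤ x ∧ x < t + p * n + p := by
  refine ⟨⌊(x - t) / p⌋, ?_, ?_⟩
  · have := Int.floor_le ((x - t) / p)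
    rw [le_div_iff₀ hp] at this
    linarith
  · have := Int.lt_floor_add_one ((x - t) / p)
    rw [div_lt_iff₀ hp] at this
    linarith

lemma mem_upright {k : ℤ} {t : ℝ} {z : ℍ} : z ∈ upright w k t ↔
    t ≤ z.re ∧ z.re ≤ t + 2 ^ k * w ∧ 2 ^ k ≤ z.im ∧ z.im ≤ 2 ^ (k + 1) := by
  have hp : (0 : ℝ) < 2 ^ k := by positivity
  have key : ∀ u : ℍ, aff k t • u ∈ upright w k t ↔ t ≤ (aff k t • u).re ∧
      (aff k t • u).re ≤ t + 2 ^ k * w ∧ 2 ^ k ≤ (aff k t • u).im ∧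
        (aff k t • u).im ≤ 2 ^ (k + 1) := by
    intro u
    rw [upright, Set.smul_mem_smul_set_iff, aff_smul_re, aff_smul_im,
      zpow_add_one₀ (two_ne_zero' ℝ), mul_le_mul_iff_right₀ hp, le_mul_iff_one_le_right hp,
      add_comm t, add_le_add_iff_right, mul_le_mul_iff_right₀ hp, le_add_iff_nonneg_left,
      mul_nonneg_iff_of_pos_left hp]
    rfl
  have := key ((aff k t)⁻¹ • z)
  rwa [smul_inv_smul] at this

lemma mem_interior_upright {k : ℤ} {t : ℝ} {z : ℍ} : z ∈ interior (upright w k t) ↔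
    t < z.re ∧ z.re < t + 2 ^ k * w ∧ 2 ^ k < z.im ∧ z.im < 2 ^ (k + 1) := by
  have hp : (0 : ℝ) < 2 ^ k := by positivity
  have key : ∀ u : ℍ, aff k t • u ∈ interior (upright w k t) ↔ t < (aff k t • u).re ∧
      (aff k t • u).re < t + 2 ^ k * w ∧ 2 ^ k < (aff k t • u).im ∧
        (aff k t • u).im < 2 ^ (k + 1) := by
    intro u
    rw [upright, interior_smul, Set.smul_mem_smul_set_iff, aff_smul_re, aff_smul_im,
      zpow_add_one₀ (two_ne_zero' ℝ), mul_lt_mul_iff_right₀ hp, lt_mul_iff_one_lt_right hp,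
      add_comm t, add_lt_add_iff_right, mul_lt_mul_iff_right₀ hp, lt_add_iff_pos_left,
      mul_pos_iff_of_pos_left hp, mem_interior_prototile]
  have := key ((aff k t)⁻¹ • z)
  rwa [smul_inv_smul] at this

lemma prototile_eq_upright : prototile w = upright w 0 0 := (aff_zero_zero_smul _).symm

lemma aff_smul_upright (k m : ℤ) (t u : ℝ) :
    aff k t • upright w m u = upright w (k + m) (2 ^ k * u + t) :=
  aff_smul_aff_smul_set k m t u _

namespace IsBTiling

variable {𝒯 : Set (Set ℍ)} {g : SL(2, ℝ)} {k : ℤ} {t u : ℝ}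

lemma upright_up (hw : 0 < w) (h𝒯 : IsBTiling w 𝒯) (h : g • upright w k t ∈ 𝒯) :
    g • upright w (k + 1) t ∈ 𝒯 ∨ g • upright w (k + 1) (t - 2 ^ k * w) ∈ 𝒯 := by
  rw [upright, smul_smul] at h
  have := h𝒯.up hw h
  rw [mul_smul, mul_smul, aff_smul_aff_smul_set, aff_smul_aff_smul_set] at this
  convert this using 4 <;> (congr 1; ring)

lemma upright_down (hw : 0 < w) (h𝒯 : IsBTiling w 𝒯) (h : g • upright w k t ∈ 𝒯) :
    g • upright w (k - 1) t ∈ 𝒯 := by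
  rw [upright, smul_smul] at h
  have := (h𝒯.down hw h).1
  rw [mul_smul, aff_smul_aff_smul_set, mul_zero, zero_add] at this
  exact this

lemma upright_add (hw : 0 < w) (h𝒯 : IsBTiling w 𝒯) (h : g • upright w k t ∈ 𝒯) (n : ℤ) :
    g • upright w k (t + 2 ^ k * w * n) ∈ 𝒯 := by
  have key : ∀ t, g • upright w k t ∈ 𝒯 →
      g • upright w k (t - 2 ^ k * w) ∈ 𝒯 ∧ g • upright w k (t + 2 ^ k * w) ∈ 𝒯 := by
    intro t h
    rw [upright, smul_smul] at h
    have := h𝒯.side hw h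
    rw [mul_smul, mul_smul, aff_smul_aff_smul_set, aff_smul_aff_smul_set, add_zero] at this
    rw [sub_eq_neg_add, add_comm t, ← mul_neg]
    exact this
  induction n with
  | zero => simpa using h
  | succ n ih =>
    convert (key _ ih).2 using 2
    congr 1
    push_cast
    ring
  | pred n ih =>
    convert (key _ ih).1 using 2
    congr 1
    push_cast
    ring

/-- Round `u` down to the translate `v` of `t` with `v ≤ u < v + 2 ^ k w`. The tiles at `v` and `u`
then overlap, hence coincide. -/
lemma upright_eq (hw : 0 < w) (h𝒯 : IsBTiling w 𝒯) (ht : g • upright w k t ∈ 𝒯)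
    (hu : g • upright w k u ∈ 𝒯) : ∃ n : ℤ, u = t + 2 ^ k * w * n := by
  have hp : (0 : ℝ) < 2 ^ k := by positivity
  have hpw : (0 : ℝ) < 2 ^ k * w := by positivity
  obtain ⟨n, h1, h2⟩ := exists_int_mul_mem hpw t u
  refine ⟨n, ?_⟩
  have hn := h𝒯.upright_add hw ht n
  set v := t + 2 ^ k * w * n
  set z : ℍ := pt ((u + (v + 2 ^ k * w)) / 2) (2 ^ k * (3 / 2)) (by positivity) with hz
  have e := h𝒯.eq_of_interior hn hu (z := g • z)
    (by
      rw [interior_smul, Set.smul_mem_smul_set_iff, mem_interior_upright,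
        zpow_add_one₀ (two_ne_zero' ℝ), hz, pt_re, pt_im]
      refine ⟨?_, ?_, ?_, ?_⟩ <;> linarith)
    (by
      rw [interior_smul, Set.smul_mem_smul_set_iff, mem_interior_upright,
        zpow_add_one₀ (two_ne_zero' ℝ), hz, pt_re, pt_im]
      refine ⟨?_, ?_, ?_, ?_⟩ <;> linarith)
  have e' : upright w k v = upright w k u := MulAction.injective g e
  have m1 : pt v (2 ^ k) hp ∈ upright w k u := by
    rw [← e', mem_upright, zpow_add_one₀ (two_ne_zero' ℝ), pt_re, pt_im]
    refine ⟨?_, ?_, ?_, ?_⟩ <;> linarith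
  rw [mem_upright, pt_re] at m1
  linarith [m1.1]

/-- Every Böröczky tiling is congruent to a tiling by upright tiles given by a grid. -/
theorem exists_grid (hw : 0 < w) (h𝒯 : IsBTiling w 𝒯) :
    ∃ (g : SL(2, ℝ)) (L : ℤ → Set ℝ), IsGrid w L ∧ 𝒯 = g • gridTiling w L := by
  obtain ⟨T₀, hT₀, -⟩ : I ∈ ⋃₀ 𝒯 := h𝒯.covers ▸ trivial
  obtain ⟨g, rfl⟩ := h𝒯.exists_smul hT₀
  rw [prototile_eq_upright] at hT₀
  set L : ℤ → Set ℝ := fun k => {t | g • upright w k t ∈ 𝒯} with hL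
  have hne : ∀ k, (L k).Nonempty := by
    intro k
    induction k with
    | zero => exact ⟨0, hT₀⟩
    | succ k ih =>
      obtain ⟨t, ht⟩ := ih
      rcases h𝒯.upright_up hw ht with h | h
      exacts [⟨_, h⟩, ⟨_, h⟩]
    | pred k ih =>
      obtain ⟨t, ht⟩ := ih
      exact ⟨t, h𝒯.upright_down hw ht⟩
  refine ⟨g, L, ⟨hne, fun k t ht n => h𝒯.upright_add hw ht n,
    fun k t ht u hu => h𝒯.upright_eq hw ht hu, fun k t ht => ?_⟩, ?_⟩
  · have := h𝒯.upright_down hw ht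
    rwa [add_sub_cancel_right] at this
  · apply Set.Subset.antisymm
    · intro T hT
      obtain ⟨f, rfl⟩ := h𝒯.exists_smul hT
      have hint : interior (f • prototile w) ≠ ∅ := by
        rw [interior_smul, Ne, Set.smul_set_eq_empty, ← Ne, ← Set.nonempty_iff_ne_empty]
        refine ⟨pt (w / 2) (3 / 2) (by norm_num), ?_⟩
        rw [mem_interior_prototile, pt_re, pt_im]
        refine ⟨?_, ?_, ?_, ?_⟩ <;> linarith
      obtain ⟨p, hp⟩ := Set.nonempty_iff_ne_empty.2 hint
      obtain ⟨k, hk1, hk2⟩ := exists_mem_Ico_zpow (g⁻¹ • p).im_pos (one_lt_two (α := ℝ))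
      obtain ⟨t, ht⟩ := hne k
      obtain ⟨n, hn1, hn2⟩ := exists_int_mul_mem (p := 2 ^ k * w) (by positivity) t (g⁻¹ • p).re
      have hmem := h𝒯.upright_add hw ht n
      -- The upright tile found by rounding may contain `p` only on its boundary; density of its
      -- interior still gives a common interior point.
      have hpS : p ∈ closure (interior (g • upright w k (t + 2 ^ k * w * n))) := by
        have h1 : g⁻¹ • p ∈ upright w k (t + 2 ^ k * w * n) :=
          mem_upright.2 ⟨hn1, hn2.le, hk1, hk2.le⟩
        rw [upright, smul_smul, interior_smul, closure_smul]
        refine Set.smul_set_mono (prototile_subset_closure_interior hw) ?_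
        rwa [mul_smul, Set.mem_smul_set_iff_inv_smul_mem]
      obtain ⟨q, hq1, hq2⟩ := mem_closure_iff.1 hpS _ isOpen_interior hp
      rw [h𝒯.eq_of_interior hT hmem hq1 hq2]
      exact Set.smul_mem_smul_set ⟨k, _, hmem, rfl⟩
    · rintro _ ⟨_, ⟨k, t, ht, rfl⟩, rfl⟩
      exact ht

end IsBTiling

end Structure


/-! ### Common horocyclic edges of upright tiles -/

section Edges

variable {w : ℝ}

lemma isEdge_upright_iff (hw : 0 < w) {j : EdgeName} {g : SL(2, ℝ)} {k : ℤ} {t : ℝ} {e : Set ℍ} :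
    IsEdge w j (g • upright w k t) e ↔ e = g • aff k t • protoEdge w j := by
  rw [upright, smul_smul, isEdge_smul_iff hw, mul_smul]

lemma aff_one_smul_b₁ : aff 1 0 • protoEdge w .b₁ = protoEdge w .a := by
  ext z
  rw [Set.mem_smul_set_iff_inv_smul_mem, aff_inv_smul]
  simp only [protoEdge, Set.mem_ofPred_eq, aff_smul_re, aff_smul_im, zpow_neg, zpow_one]
  constructor <;> rintro ⟨h1, h2, h3⟩ <;> refine ⟨?_, ?_, ?_⟩ <;> linarith

lemma aff_one_smul_b₂ : aff 1 (-w) • protoEdge w .b₂ = protoEdge w .a := by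
  ext z
  rw [Set.mem_smul_set_iff_inv_smul_mem, aff_inv_smul]
  simp only [protoEdge, Set.mem_ofPred_eq, aff_smul_re, aff_smul_im, zpow_neg, zpow_one]
  constructor <;> rintro ⟨h1, h2, h3⟩ <;> refine ⟨?_, ?_, ?_⟩ <;> linarith

lemma aff_smul_a_eq_b₁ (k : ℤ) (t : ℝ) :
    aff k t • protoEdge w .a = aff (k + 1) t • protoEdge w .b₁ := by
  rw [← aff_one_smul_b₁, aff_smul_aff_smul_set, mul_zero, zero_add]

lemma aff_smul_a_eq_b₂ (k : ℤ) (t : ℝ) :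
    aff k t • protoEdge w .a = aff (k + 1) (t - 2 ^ k * w) • protoEdge w .b₂ := by
  rw [← aff_one_smul_b₂, aff_smul_aff_smul_set, mul_neg, sub_eq_neg_add]

/-- The quotient of the two affine maps takes one edge of the prototile to another, so it is on the
list of `affine_of_edge`; its value at `i` yields `m` and `u`. -/
lemma edge_eq_cases (hw : 0 < w) {j j' : EdgeName} {k m : ℤ} {t u : ℝ}
    (hj : j = .a ∨ j = .b₁ ∨ j = .b₂)
    (h : aff k t • protoEdge w j = aff m u • protoEdge w j') :
    (j = j' ∧ m = k ∧ u = t) ∨ (j = .a ∧ j' = .b₁ ∧ m = k + 1 ∧ u = t) ∨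
      (j = .a ∧ j' = .b₂ ∧ m = k + 1 ∧ u = t - 2 ^ k * w) ∨
      (j = .b₁ ∧ j' = .a ∧ m = k - 1 ∧ u = t) ∨
      (j = .b₂ ∧ j' = .a ∧ m = k - 1 ∧ u = t + 2 ^ k * (w / 2)) ∨
      (j = .b₁ ∧ j' = .b₂ ∧ m = k ∧ u = t + 2 ^ k * -(w / 2)) ∨
      (j = .b₂ ∧ j' = .b₁ ∧ m = k ∧ u = t + 2 ^ k * (w / 2)) := by
  have hp : (0 : ℝ) < 2 ^ k := by positivity
  obtain ⟨α, β, hf, hcase⟩ := affine_of_edge hw (f := (aff k t)⁻¹ * aff m u) (k := j') hj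
    (by rw [mul_smul, ← h, inv_smul_smul])
  have key : ∀ z : ℍ, 2 ^ m * z.re + u = 2 ^ k * (α * z.re + β) + t ∧
      2 ^ m * z.im = 2 ^ k * (α * z.im) := by
    intro z
    obtain ⟨h1, h2⟩ := hf z
    rw [← h1, ← h2, ← aff_smul_re k t, ← aff_smul_im k t, mul_smul, smul_inv_smul, aff_smul_re,
      aff_smul_im]
    exact ⟨rfl, rfl⟩
  have e1 := (key (pt 0 1 one_pos)).2
  have e2 := (key (pt 0 1 one_pos)).1
  simp only [pt_re, pt_im, mul_one, mul_zero, zero_add] at e1 e2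
  have hinj : ∀ d : ℤ, α = 2 ^ d → m = k + d := by
    intro d hd
    rw [hd, ← zpow_add₀ (two_ne_zero' ℝ)] at e1
    exact zpow_right_injective₀ (by norm_num) (by norm_num) e1
  have h0 : α = 1 → m = k := by simpa using hinj 0
  rcases hcase with ⟨h1, h2, h3⟩ | ⟨h1, h1', h2, h3⟩ | ⟨h1, h1', h2, h3⟩ | ⟨h1, h1', h2, h3⟩ |
    ⟨h1, h1', h2, h3⟩ | ⟨h1, h1', h2, h3⟩ | ⟨h1, h1', h2, h3⟩
  · exact Or.inl ⟨h1, h0 h2, by rw [e2, h3]; ring⟩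
  · exact Or.inr (Or.inl ⟨h1, h1', hinj 1 (by simpa using h2), by rw [e2, h3]; ring⟩)
  · exact Or.inr (Or.inr (Or.inl ⟨h1, h1', hinj 1 (by simpa using h2), by rw [e2, h3]; ring⟩))
  · exact Or.inr (Or.inr (Or.inr (Or.inl ⟨h1, h1', hinj (-1) (by simpa using h2),
      by rw [e2, h3]; ring⟩)))
  · exact Or.inr (Or.inr (Or.inr (Or.inr (Or.inl ⟨h1, h1', hinj (-1) (by simpa using h2),
      by rw [e2, h3]; ring⟩))))
  · exact Or.inr (Or.inr (Or.inr (Or.inr (Or.inr (Or.inl ⟨h1, h1', h0 h2,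
      by rw [e2, h3]; ring⟩)))))
  · exact Or.inr (Or.inr (Or.inr (Or.inr (Or.inr (Or.inr ⟨h1, h1', h0 h2,
      by rw [e2, h3]; ring⟩)))))

lemma upright_injective (hw : 0 < w) {g : SL(2, ℝ)} {k m : ℤ} {t u : ℝ}
    (h : g • upright w k t = g • upright w m u) : k = m ∧ t = u := by
  have h1 : (aff m u) • prototile w = aff k t • prototile w := (MulAction.injective g h).symm
  have h2 := smul_set_eq_smul_set_of_prototile hw h1 (protoEdge w .a)
  rcases edge_eq_cases hw (by simp) h2 with h | h | h | h | h | h | h <;> simp_all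

end Edges

/-! ### Nested cosets and their common point -/

section Grid

variable {w : ℝ} {L : ℤ → Set ℝ}

namespace IsGrid

/-- This `t` is the left end of the tile of level `k` whose vertical strip contains `x`. -/
lemma exists_floor (hw : 0 < w) (hL : IsGrid w L) (k : ℤ) (x : ℝ) :
    ∃ t ∈ L k, t ≤ x ∧ x < t + 2 ^ k * w := by
  obtain ⟨t, ht⟩ := hL.nonempty k
  obtain ⟨n, h1, h2⟩ := exists_int_mul_mem (p := 2 ^ k * w) (by positivity) t x
  exact ⟨_, hL.add_mem k t ht n, h1, h2⟩

lemma antitone (hL : IsGrid w L) {k m : ℤ} (h : k ≤ m) : L m ⊆ L k := by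
  induction m, h using Int.leInduction with
  | base => exact subset_rfl
  | succ m _ ih => exact (hL.succ_subset m).trans ih

/-- Different points of `L k` have distance at least `2 ^ k w`. -/
lemma add_le (hw : 0 < w) (hL : IsGrid w L) {k : ℤ} {t u : ℝ} (ht : t ∈ L k) (hu : u ∈ L k)
    (h : t < u) : t + 2 ^ k * w ≤ u := by
  obtain ⟨n, rfl⟩ := hL.exists_eq k t ht u hu
  have hp : (0 : ℝ) < 2 ^ k * w := by positivity
  have hn : 0 < n := by
    have : 0 < 2 ^ k * w * n := by linarith
    exact_mod_cast pos_of_mul_pos_right this hp.le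
  have : (1 : ℝ) ≤ n := by exact_mod_cast hn
  nlinarith

lemma eq_of_lt (hw : 0 < w) (hL : IsGrid w L) {k : ℤ} {t u : ℝ} (ht : t ∈ L k) (hu : u ∈ L k)
    (h1 : t < u + 2 ^ k * w) (h2 : u < t + 2 ^ k * w) : t = u := by
  rcases lt_trichotomy t u with h | h | h
  · linarith [hL.add_le hw ht hu h]
  · exact h
  · linarith [hL.add_le hw hu ht h]

lemma two_zpow_succ_mul (k : ℤ) (w : ℝ) : (2 : ℝ) ^ (k + 1) * w = 2 ^ k * w + 2 ^ k * w := by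
  rw [zpow_add_one₀ (two_ne_zero' ℝ)]
  ring

/-- The tile above a tile. -/
lemma parent_cases (hw : 0 < w) (hL : IsGrid w L) {k : ℤ} {x t u : ℝ} (ht : t ∈ L k)
    (hu : u ∈ L (k + 1)) (h1 : t ≤ x) (h2 : x < t + 2 ^ k * w) (h3 : u ≤ x)
    (h4 : x < u + 2 ^ (k + 1) * w) : u = t ∨ u = t - 2 ^ k * w := by
  have hp : (0 : ℝ) < 2 ^ k * w := by positivity
  have hu' := hL.succ_subset k hu
  rw [two_zpow_succ_mul] at h4
  have hle : u ≤ t := by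
    by_contra! h
    linarith [hL.add_le hw ht hu' h]
  rcases hle.eq_or_lt with h | h
  · exact Or.inl h
  · right
    have h5 := hL.add_mem k u hu' 1
    rw [Int.cast_one, mul_one] at h5
    have := hL.eq_of_lt hw ht h5 (by linarith) (by linarith)
    linarith

lemma exists_zpow_mul_gt (hw : 0 < w) (x : ℝ) (m : ℤ) : ∃ k : ℤ, m ≤ k ∧ x < 2 ^ k * w := by
  obtain ⟨n, hn⟩ := pow_unbounded_of_one_lt (x / w) (one_lt_two (α := ℝ))
  refine ⟨max m n, le_max_left _ _, ?_⟩
  rw [div_lt_iff₀ hw] at hn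
  refine hn.trans_le ?_
  have : (2 : ℝ) ^ n ≤ 2 ^ (max m (n : ℤ)) := by
    rw [← zpow_natCast]
    exact zpow_le_zpow_right₀ one_le_two (le_max_right _ _)
  gcongr

/-- There is at most one vertical line consisting of sides of tiles. -/
lemma eq_of_mem_iInter (hw : 0 < w) (hL : IsGrid w L) {x y : ℝ} (hx : ∀ k, x ∈ L k)
    (hy : ∀ k, y ∈ L k) : x = y := by
  obtain ⟨k, -, hk⟩ := exists_zpow_mul_gt hw |x - y| 0
  rw [abs_lt] at hk
  exact hL.eq_of_lt hw (hx k) (hy k) (by linarith) (by linarith)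

/-- If a point of every level in `(t, u]` exists, then all levels have one in common. -/
lemma exists_mem_iInter (hw : 0 < w) (hL : IsGrid w L) {t u : ℝ} {m : ℤ}
    (h : ∀ k, m ≤ k → ∃ p ∈ L k, t < p ∧ p ≤ u) : ∃ x, (∀ k, x ∈ L k) ∧ t < x ∧ x ≤ u := by
  -- Once the spacing exceeds `u - t`, the interval holds only one grid point; the points found at
  -- higher levels must equal it.
  obtain ⟨k, hmk, hk⟩ := exists_zpow_mul_gt hw (u - t) m
  obtain ⟨p, hp, h1, h2⟩ := h k hmk
  refine ⟨p, fun n => ?_, h1, h2⟩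
  obtain ⟨q, hq, h3, h4⟩ := h (max k n) (hmk.trans (le_max_left _ _))
  have hqk := hL.antitone (le_max_left k n) hq
  have : p = q := hL.eq_of_lt hw hp hqk (by linarith) (by linarith)
  rw [this]
  exact hL.antitone (le_max_right k n) hq

end IsGrid

end Grid

/-! ### Counting the pools -/

section Pools

variable {w : ℝ} {L : ℤ → Set ℝ} {g : SL(2, ℝ)} {𝒯 : Set (Set ℍ)}

/-- Two tiles are adjacent if they share an edge which is not a `c`-edge. -/
def horocyclicGraph (w : ℝ) (𝒯 : Set (Set ℍ)) : SimpleGraph (Set ℍ) where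
  Adj T T' := T ≠ T' ∧ T ∈ 𝒯 ∧ T' ∈ 𝒯 ∧ ∃ e, IsHorocyclicEdge w T e ∧ IsHorocyclicEdge w T' e
  symm := ⟨fun _ _ ⟨h1, h2, h3, e, h4, h5⟩ => ⟨h1.symm, h3, h2, e, h5, h4⟩⟩
  loopless := ⟨fun _ h => h.1 rfl⟩

/-- A walk can be shortened to a path without repetitions, so the requirement of pairwise different
tiles costs nothing and pools are connected components. -/
lemma mem_pool_iff {T T' : Set ℍ} (hT : T ∈ 𝒯) :
    T' ∈ pool w 𝒯 T ↔ (horocyclicGraph w 𝒯).Reachable T T' := by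
  constructor
  · rintro ⟨n, p, ⟨h1, h2, h3⟩, rfl, rfl⟩
    have : ∀ i ≤ n, (horocyclicGraph w 𝒯).Reachable (p 0) (p i) := by
      intro i
      induction i with
      | zero => exact fun _ => SimpleGraph.Reachable.refl _
      | succ i ih =>
        intro hi
        refine (ih (by omega)).trans (SimpleGraph.Adj.reachable ⟨?_, h1 _ (by omega), h1 _ hi,
          h3 i (by omega)⟩)
        intro h
        have := h2 (Set.mem_Iic.2 (by omega)) (Set.mem_Iic.2 hi) h
        omega
    exact this n le_rfl
  · intro h
    obtain ⟨p, hp⟩ := h.exists_isPath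
    refine ⟨p.length, p.getVert, ⟨?_, hp.getVert_injOn, ?_⟩, p.getVert_zero, p.getVert_length⟩
    · intro i hi
      rcases Nat.eq_zero_or_pos i with rfl | h0
      · rwa [p.getVert_zero]
      · obtain ⟨j, rfl⟩ : ∃ j, i = j + 1 := ⟨i - 1, by omega⟩
        exact (p.adj_getVert_succ (i := j) (by omega)).2.2.1
    · intro i hi
      exact (p.adj_getVert_succ hi).2.2.2

lemma smul_upright_mem {k : ℤ} {t : ℝ} (ht : t ∈ L k) :
    g • upright w k t ∈ g • gridTiling w L :=
  Set.smul_mem_smul_set ⟨k, t, ht, rfl⟩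

lemma adj_parent (hw : 0 < w) {k : ℤ} {t u : ℝ} (ht : t ∈ L k)
    (hu : u ∈ L (k + 1)) (h : u = t ∨ u = t - 2 ^ k * w) :
    (horocyclicGraph w (g • gridTiling w L)).Adj (g • upright w k t) (g • upright w (k + 1) u) := by
  refine ⟨fun h => by simpa using (upright_injective hw h).1, smul_upright_mem ht,
    smul_upright_mem hu, g • aff k t • protoEdge w .a, Or.inl ((isEdge_upright_iff hw).2 rfl), ?_⟩
  rcases h with rfl | rfl
  · exact Or.inr (Or.inl ((isEdge_upright_iff hw).2 (by rw [aff_smul_a_eq_b₁])))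
  · exact Or.inr (Or.inr ((isEdge_upright_iff hw).2 (by rw [aff_smul_a_eq_b₂])))

/-- Apart from parent and child, a shared edge could only be `b₁` of one tile and `b₂` of another on
the same level, at a distance of half a width, which the grid forbids. -/
lemma adj_cases (hw : 0 < w) (hL : IsGrid w L) {T T' : Set ℍ}
    (h : (horocyclicGraph w (g • gridTiling w L)).Adj T T') :
    ∃ (k : ℤ) (t u : ℝ), t ∈ L k ∧ u ∈ L (k + 1) ∧ (u = t ∨ u = t - 2 ^ k * w) ∧
      ((T = g • upright w k t ∧ T' = g • upright w (k + 1) u) ∨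
        (T' = g • upright w k t ∧ T = g • upright w (k + 1) u)) := by
  obtain ⟨hne, ⟨_, ⟨k, t, ht, rfl⟩, rfl⟩, ⟨_, ⟨m, u, hu, rfl⟩, rfl⟩, e, h1, h2⟩ := h
  have hname : ∀ {k t}, IsHorocyclicEdge w (g • upright w k t) e →
      ∃ j, (j = EdgeName.a ∨ j = .b₁ ∨ j = .b₂) ∧ e = g • aff k t • protoEdge w j := by
    rintro k t (h | h | h)
    · exact ⟨.a, by simp, (isEdge_upright_iff hw).1 h⟩
    · exact ⟨.b₁, by simp, (isEdge_upright_iff hw).1 h⟩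
    · exact ⟨.b₂, by simp, (isEdge_upright_iff hw).1 h⟩
  obtain ⟨j, hj, rfl⟩ := hname h1
  obtain ⟨j', -, he⟩ := hname h2
  have hp : (0 : ℝ) < 2 ^ k * w := by positivity
  rcases edge_eq_cases hw hj (MulAction.injective g he) with ⟨-, rfl, rfl⟩ | ⟨-, -, rfl, rfl⟩ |
    ⟨-, -, rfl, rfl⟩ | ⟨-, -, rfl, rfl⟩ | ⟨-, -, rfl, rfl⟩ | ⟨-, -, rfl, rfl⟩ | ⟨-, -, rfl, rfl⟩
  · exact (hne rfl).elim
  · exact ⟨k, _, _, ht, hu, Or.inl rfl, Or.inl ⟨rfl, rfl⟩⟩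
  · exact ⟨k, _, _, ht, hu, Or.inr rfl, Or.inl ⟨rfl, rfl⟩⟩
  · refine ⟨k - 1, _, _, hu, by rwa [sub_add_cancel], Or.inl rfl, Or.inr ⟨rfl, ?_⟩⟩
    rw [sub_add_cancel]
  · refine ⟨k - 1, _, t, hu, by rwa [sub_add_cancel], Or.inr ?_, Or.inr ⟨rfl, ?_⟩⟩
    · rw [zpow_sub_one₀ (two_ne_zero' ℝ)]
      ring
    · rw [sub_add_cancel]
  · have := hL.eq_of_lt hw ht hu (by linarith) (by linarith)
    linarith
  · have := hL.eq_of_lt hw ht hu (by linarith) (by linarith)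
    linarith

/-- Climb one level at a time through the tiles whose strips contain `x`. -/
lemma reachable_ancestor (hw : 0 < w) (hL : IsGrid w L) {k m : ℤ} {x t u : ℝ} (hkm : k ≤ m)
    (ht : t ∈ L k) (h1 : t ≤ x) (h2 : x < t + 2 ^ k * w) (hu : u ∈ L m) (h3 : u ≤ x)
    (h4 : x < u + 2 ^ m * w) :
    (horocyclicGraph w (g • gridTiling w L)).Reachable (g • upright w k t) (g • upright w m u) := by
  induction m, hkm using Int.leInduction generalizing u with
  | base =>
    rw [hL.eq_of_lt hw ht hu (by linarith) (by linarith)]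
  | succ m _ ih =>
    obtain ⟨v, hv, h5, h6⟩ := hL.exists_floor hw m x
    exact (ih hv h5 h6).trans
      (adj_parent hw hv hu (hL.parent_cases hw hv hu h5 h6 h3 h4)).reachable

/-- Either some high strip contains both `t` and `u`, giving a common ancestor, or at each high
level the right end of the strip over `t` separates them. -/
lemma reachable_or_exists_mem_iInter (hw : 0 < w) (hL : IsGrid w L) {k m : ℤ} {t u : ℝ}
    (ht : t ∈ L k) (hu : u ∈ L m) (htu : t ≤ u) :
    (horocyclicGraph w (g • gridTiling w L)).Reachable (g • upright w k t) (g • upright w m u) ∨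
      ∃ x, (∀ k, x ∈ L k) ∧ t < x ∧ x ≤ u := by
  by_cases h : ∃ n, max k m ≤ n ∧ ∃ p ∈ L n, p ≤ t ∧ u < p + 2 ^ n * w
  · left
    obtain ⟨n, hn, p, hp, h1, h2⟩ := h
    have hk : (0 : ℝ) < 2 ^ k * w := by positivity
    have hm : (0 : ℝ) < 2 ^ m * w := by positivity
    exact (reachable_ancestor hw hL (x := t) ((le_max_left _ _).trans hn) ht le_rfl (by linarith)
      hp h1 (by linarith)).trans
      (reachable_ancestor hw hL (x := u) ((le_max_right _ _).trans hn) hu le_rfl (by linarith)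
        hp (by linarith) h2).symm
  · right
    push Not at h
    refine hL.exists_mem_iInter hw (m := max k m) fun n hn => ?_
    obtain ⟨p, hp, h1, h2⟩ := hL.exists_floor hw n t
    refine ⟨p + 2 ^ n * w, ?_, h2, h n hn p hp h1⟩
    simpa using hL.add_mem n p hp 1

lemma pool_eq_of_reachable {T T' : Set ℍ} (hT : T ∈ 𝒯) (hT' : T' ∈ 𝒯)
    (h : (horocyclicGraph w 𝒯).Reachable T T') : pool w 𝒯 T = pool w 𝒯 T' := by
  ext S
  rw [mem_pool_iff hT, mem_pool_iff hT']
  exact ⟨fun h' => h.symm.trans h', fun h' => h.trans h'⟩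

theorem encard_pools_eq_one (hw : 0 < w) (hL : IsGrid w L) (h : ¬ ∃ x, ∀ k, x ∈ L k) :
    (pools w (g • gridTiling w L)).encard = 1 := by
  obtain ⟨t, ht⟩ := hL.nonempty 0
  rw [Set.encard_eq_one]
  refine ⟨pool w (g • gridTiling w L) (g • upright w 0 t), ?_⟩
  apply Set.Subset.antisymm
  · rintro _ ⟨_, ⟨_, ⟨k, u, hu, rfl⟩, rfl⟩, rfl⟩
    rw [Set.mem_singleton_iff]
    apply pool_eq_of_reachable (smul_upright_mem hu) (smul_upright_mem ht)
    rcases le_total u t with htu | htu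
    · rcases reachable_or_exists_mem_iInter hw hL hu ht htu with h' | ⟨x, hx, -⟩
      · exact h'
      · exact (h ⟨x, hx⟩).elim
    · rcases reachable_or_exists_mem_iInter hw hL ht hu htu with h' | ⟨x, hx, -⟩
      · exact h'.symm
      · exact (h ⟨x, hx⟩).elim
  · rintro _ rfl
    exact ⟨_, smul_upright_mem ht, rfl⟩

/-- A horocyclic path does not cross a line consisting of sides of tiles. -/
lemma right_of_reachable (hw : 0 < w) (hL : IsGrid w L) {x : ℝ} (hx : ∀ k, x ∈ L k)
    {T T' : Set ℍ} (h : (horocyclicGraph w (g • gridTiling w L)).Reachable T T')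
    (hT : ∃ k t, x ≤ t ∧ T = g • upright w k t) : ∃ k t, x ≤ t ∧ T' = g • upright w k t := by
  obtain ⟨p⟩ := h
  induction p with
  | nil => exact hT
  | cons hadj _ ih =>
    apply ih
    obtain ⟨k, t, u, ht, hu, hc, ⟨rfl, rfl⟩ | ⟨rfl, rfl⟩⟩ := adj_cases hw hL hadj
    · refine ⟨k + 1, u, ?_, rfl⟩
      obtain ⟨k', t', hxt', e⟩ := hT
      obtain ⟨rfl, rfl⟩ := upright_injective hw e
      by_contra! hlt
      have h1 := hL.add_le hw hu (hx _) hlt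
      rw [IsGrid.two_zpow_succ_mul] at h1
      have hp : (0 : ℝ) < 2 ^ k * w := by positivity
      rcases hc with rfl | rfl <;> linarith
    · refine ⟨k, t, ?_, rfl⟩
      obtain ⟨k', t', hxt', e⟩ := hT
      obtain ⟨rfl, rfl⟩ := upright_injective hw e
      have hp : (0 : ℝ) < 2 ^ k * w := by positivity
      rcases hc with rfl | rfl <;> linarith

theorem encard_pools_eq_two (hw : 0 < w) (hL : IsGrid w L) {x : ℝ} (hx : ∀ k, x ∈ L k) :
    (pools w (g • gridTiling w L)).encard = 2 := by
  have hx' : x - w ∈ L 0 := by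
    have := hL.add_mem 0 x (hx 0) (-1)
    simpa [sub_eq_add_neg] using this
  rw [Set.encard_eq_two]
  refine ⟨pool w (g • gridTiling w L) (g • upright w 0 x),
    pool w (g • gridTiling w L) (g • upright w 0 (x - w)), ?_, ?_⟩
  · intro h
    have hm : g • upright w 0 (x - w) ∈ pool w (g • gridTiling w L) (g • upright w 0 x) := by
      rw [h, mem_pool_iff (smul_upright_mem hx')]
    rw [mem_pool_iff (smul_upright_mem (hx 0))] at hm
    obtain ⟨k, t, hxt, e⟩ := right_of_reachable hw hL hx hm ⟨0, x, le_rfl, rfl⟩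
    obtain ⟨rfl, rfl⟩ := upright_injective hw e
    linarith
  · apply Set.Subset.antisymm
    · rintro _ ⟨_, ⟨_, ⟨k, u, hu, rfl⟩, rfl⟩, rfl⟩
      rw [Set.mem_insert_iff, Set.mem_singleton_iff]
      -- Two unlinked tiles on the same side of `x` would be separated by a second point common to
      -- all levels.
      have key : ∀ {m n : ℤ} {t u : ℝ}, t ∈ L m → u ∈ L n → (x ≤ t ∨ u < x) → t ≤ u →
          (horocyclicGraph w (g • gridTiling w L)).Reachable (g • upright w m t)
            (g • upright w n u) := by
        intro m n t u ht hu hc htu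
        rcases reachable_or_exists_mem_iInter (g := g) hw hL ht hu htu with h | ⟨y, hy, h1, h2⟩
        · exact h
        · have := hL.eq_of_mem_iInter hw hx hy
          rcases hc with hc | hc <;> linarith
      rcases le_or_gt x u with h | h
      · left
        exact pool_eq_of_reachable (smul_upright_mem hu) (smul_upright_mem (hx 0))
          (key (hx 0) hu (Or.inl le_rfl) h).symm
      · right
        apply pool_eq_of_reachable (smul_upright_mem hu) (smul_upright_mem hx')
        rcases le_total u (x - w) with h' | h'
        · exact key hu hx' (Or.inr (by linarith)) h'
        · exact (key hx' hu (Or.inr h) h').symm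
    · rintro _ (rfl | rfl)
      · exact ⟨_, smul_upright_mem (hx 0), rfl⟩
      · exact ⟨_, smul_upright_mem hx', rfl⟩

end Pools


/-! ### Affine isometries and upright tiles -/

section Affine

variable {w : ℝ}

/-- `φ` is the map `x + iy ↦ σ 2 ^ m x + t + i 2 ^ m y`. -/
def IsAffine (φ : ℍ ≃ᵢ ℍ) (σ : ℝ) (m : ℤ) (t : ℝ) : Prop :=
  (σ = 1 ∨ σ = -1) ∧ ∀ z, (φ z).re = σ * 2 ^ m * z.re + t ∧ (φ z).im = 2 ^ m * z.im

namespace IsAffine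

variable {φ ψ : ℍ ≃ᵢ ℍ} {σ τ : ℝ} {m n : ℤ} {t u : ℝ}

lemma ext (hφ : IsAffine φ σ m t) (hψ : IsAffine ψ σ m t) : φ = ψ := by
  ext1 z
  exact UpperHalfPlane.ext_re_im ((hφ.2 z).1.trans (hψ.2 z).1.symm)
    ((hφ.2 z).2.trans (hψ.2 z).2.symm)

lemma one : IsAffine 1 1 0 0 := ⟨Or.inl rfl, fun z => by simp⟩

lemma mul (hφ : IsAffine φ σ m t) (hψ : IsAffine ψ τ n u) :
    IsAffine (φ * ψ) (σ * τ) (m + n) (σ * 2 ^ m * u + t) := by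
  refine ⟨?_, fun z => ?_⟩
  · rcases hφ.1 with rfl | rfl <;> rcases hψ.1 with rfl | rfl <;> simp
  · rw [IsometryEquiv.mul_apply, (hφ.2 _).1, (hφ.2 _).2, (hψ.2 _).1, (hψ.2 _).2,
      zpow_add₀ (two_ne_zero' ℝ)]
    constructor <;> ring

lemma refl : IsAffine reflIso (-1) 0 0 := ⟨Or.inr rfl, fun z => by simp⟩

lemma slIso_aff (m : ℤ) (t : ℝ) : IsAffine (slIso (aff m t)) 1 m t :=
  ⟨Or.inl rfl, fun z => by simp⟩

lemma exists_isometry (hσ : σ = 1 ∨ σ = -1) (m : ℤ) (t : ℝ) : ∃ φ, IsAffine φ σ m t := by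
  rcases hσ with rfl | rfl
  · exact ⟨_, slIso_aff m t⟩
  · exact ⟨_, by simpa using (slIso_aff m t).mul refl⟩

lemma inv (hφ : IsAffine φ σ m t) : IsAffine φ⁻¹ σ (-m) (-(σ * 2 ^ (-m) * t)) := by
  obtain ⟨ψ, hψ⟩ := exists_isometry hφ.1 (-m) (-(σ * 2 ^ (-m) * t))
  have h := hψ.mul hφ
  have hs : σ * σ = 1 := by rcases hφ.1 with rfl | rfl <;> norm_num
  rw [hs, neg_add_cancel, add_neg_cancel] at h
  rwa [← eq_inv_of_mul_eq_one_left (h.ext one)]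

/-- The left side of the image of an upright tile. -/
lemma image_upright (hφ : IsAffine φ σ m t) (k : ℤ) (u : ℝ) :
    (σ = 1 → φ '' upright w k u = upright w (k + m) (2 ^ m * u + t)) ∧
    (σ = -1 → φ '' upright w k u = upright w (k + m) (-(2 ^ m * u) + t - 2 ^ (k + m) * w)) := by
  have hp : (0 : ℝ) < 2 ^ m := by positivity
  have hpow : (2 : ℝ) ^ (k + m) = 2 ^ m * 2 ^ k := by
    rw [zpow_add₀ (two_ne_zero' ℝ), mul_comm]
  have hpow' : (2 : ℝ) ^ (k + m + 1) = 2 ^ m * 2 ^ (k + 1) := by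
    rw [add_right_comm, zpow_add₀ (two_ne_zero' ℝ), mul_comm]
  have himg : ∀ v, (∀ y, y ∈ upright w k u ↔ φ y ∈ upright w (k + m) v) →
      φ '' upright w k u = upright w (k + m) v := by
    intro v h
    apply Set.Subset.antisymm
    · rintro _ ⟨y, hy, rfl⟩
      exact (h y).1 hy
    · intro z hz
      refine ⟨φ.symm z, (h _).2 ?_, φ.apply_symm_apply z⟩
      rwa [φ.apply_symm_apply]
  constructor
  · rintro rfl
    refine himg _ fun y => ?_
    obtain ⟨h1, h2⟩ := hφ.2 y
    rw [mem_upright, mem_upright, h1, h2, hpow, hpow', mul_le_mul_iff_right₀ hp,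
      mul_le_mul_iff_right₀ hp, one_mul, add_le_add_iff_right, mul_le_mul_iff_right₀ hp,
      show 2 ^ m * u + t + 2 ^ m * 2 ^ k * w = 2 ^ m * (u + 2 ^ k * w) + t by ring,
      add_le_add_iff_right, mul_le_mul_iff_right₀ hp]
  · rintro rfl
    refine himg _ fun y => ?_
    obtain ⟨h1, h2⟩ := hφ.2 y
    rw [mem_upright, mem_upright, h1, h2, hpow, hpow', mul_le_mul_iff_right₀ hp,
      mul_le_mul_iff_right₀ hp,
      show -(2 ^ m * u) + t - 2 ^ m * 2 ^ k * w = -(2 ^ m * (u + 2 ^ k * w)) + t by ring,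
      show -(2 ^ m * (u + 2 ^ k * w)) + t + 2 ^ m * 2 ^ k * w = -(2 ^ m * u) + t by ring,
      show -1 * 2 ^ m * y.re + t = -(2 ^ m * y.re) + t by ring,
      add_le_add_iff_right, add_le_add_iff_right, neg_le_neg_iff, neg_le_neg_iff,
      mul_le_mul_iff_right₀ hp, mul_le_mul_iff_right₀ hp]
    tauto

end IsAffine

/-- A Möbius transformation is determined by the image of one tile, because the stabiliser acts
trivially. -/
lemma isAffine_of_smul_upright (hw : 0 < w) {f : SL(2, ℝ)} {k m : ℤ} {u v : ℝ}
    (h : f • upright w k u = upright w m v) :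
    IsAffine (slIso f) 1 (m - k) (v - 2 ^ (m - k) * u) := by
  refine ⟨Or.inl rfl, fun z => ?_⟩
  rw [upright, smul_smul] at h
  have := smul_eq_smul_of_prototile hw h ((aff k u)⁻¹ • z)
  rw [mul_smul, smul_inv_smul, aff_inv_smul, aff_smul_aff_smul] at this
  rw [slIso_apply, this, aff_smul_re, aff_smul_im, sub_eq_add_neg, zpow_add₀ (two_ne_zero' ℝ)]
  constructor <;> ring

end Affine

/-! ### The symmetry group of a grid tiling -/

section Symmetry

variable {w : ℝ} {L : ℤ → Set ℝ}

lemma mem_symmetryGroup_iff {𝒯 : Set (Set ℍ)} {φ : ℍ ≃ᵢ ℍ} :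
    φ ∈ symmetryGroup 𝒯 ↔ (fun T : Set ℍ => φ '' T) '' 𝒯 = 𝒯 := Iff.rfl

lemma image_mem_of_mem_symmetryGroup {𝒯 : Set (Set ℍ)} {φ : ℍ ≃ᵢ ℍ} (hφ : φ ∈ symmetryGroup 𝒯)
    {T : Set ℍ} (hT : T ∈ 𝒯) : φ '' T ∈ 𝒯 :=
  (mem_symmetryGroup_iff.1 hφ) ▸ Set.mem_image_of_mem _ hT

lemma upright_mem_gridTiling_iff (hw : 0 < w) {k : ℤ} {t : ℝ} :
    upright w k t ∈ gridTiling w L ↔ t ∈ L k := by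
  constructor
  · rintro ⟨m, u, hu, h⟩
    obtain ⟨rfl, rfl⟩ := upright_injective hw (congrArg (fun T : Set ℍ => (1 : SL(2, ℝ)) • T) h)
    exact hu
  · exact fun h => ⟨k, t, h, rfl⟩

/-- A symmetry of a grid tiling is an affine map. -/
lemma exists_isAffine (hw : 0 < w) (hL : IsGrid w L) {φ : ℍ ≃ᵢ ℍ}
    (hφ : φ ∈ symmetryGroup (gridTiling w L)) : ∃ σ m t, IsAffine φ σ m t := by
  obtain ⟨u, hu⟩ := hL.nonempty 0
  obtain ⟨k, v, -, h⟩ := image_mem_of_mem_symmetryGroup hφ ((upright_mem_gridTiling_iff hw).2 hu)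
  obtain ⟨f, rfl | rfl⟩ := isometry_eq_slIso_or φ
  · exact ⟨_, _, _, isAffine_of_smul_upright hw h⟩
  · have h1 : reflIso '' upright w 0 u = _ := (IsAffine.refl.image_upright 0 u).2 rfl
    have h2 : (slIso f * reflIso) '' upright w 0 u = slIso f '' (reflIso '' upright w 0 u) :=
      Set.image_comp (slIso f) reflIso _
    rw [h2, h1] at h
    exact ⟨_, _, _, (isAffine_of_smul_upright hw h).mul IsAffine.refl⟩

/-- The symmetries of a grid tiling are the affine maps preserving the grid. -/
lemma IsAffine.mem_symmetryGroup_iff (hw : 0 < w) (hL : IsGrid w L) {φ : ℍ ≃ᵢ ℍ} {σ : ℝ} {m : ℤ}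
    {t : ℝ} (hφ : IsAffine φ σ m t) :
    φ ∈ symmetryGroup (gridTiling w L) ↔ ∀ k, ∀ u ∈ L k, σ * 2 ^ m * u + t ∈ L (k + m) := by
  -- A reflection turns right sides into left sides, so the new left end is off by one width; hence
  -- `n = -1`, which the coset absorbs.
  have himg : ∀ k u, ∃ n : ℤ, φ '' upright w k u =
      upright w (k + m) (σ * 2 ^ m * u + t + 2 ^ (k + m) * w * n) := by
    intro k u
    obtain ⟨h1, h2⟩ := hφ.image_upright (w := w) k u
    rcases hφ.1 with h | h
    · exact ⟨0, by rw [h1 h, h]; congr 1; simp⟩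
    · exact ⟨-1, by rw [h2 h, h]; congr 1; push_cast; ring⟩
  constructor
  · intro h k u hu
    have h1 := image_mem_of_mem_symmetryGroup h ((upright_mem_gridTiling_iff hw).2 hu)
    obtain ⟨n, hn⟩ := himg k u
    rw [hn, upright_mem_gridTiling_iff hw] at h1
    have := hL.add_mem _ _ h1 (-n)
    convert this using 1
    push_cast
    ring
  · intro h
    rw [Boroczky.mem_symmetryGroup_iff]
    apply Set.Subset.antisymm
    · rintro _ ⟨_, ⟨k, u, hu, rfl⟩, rfl⟩
      obtain ⟨n, hn⟩ := himg k u
      exact ⟨k + m, _, hL.add_mem _ _ (h k u hu) n, hn⟩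
    -- Since `L k` is a single coset, one image tile of level `k` is enough: the others come from
    -- translating its preimage. A reflection reverses the translation, hence the factor `s = σ`.
    · rintro _ ⟨k, v, hv, rfl⟩
      obtain ⟨u, hu⟩ := hL.nonempty (k - m)
      obtain ⟨n, hn⟩ := himg (k - m) u
      have hu' := hL.add_mem _ _ (h _ _ hu) n
      rw [sub_add_cancel] at hn hu'
      obtain ⟨l, hl⟩ := hL.exists_eq _ _ hu' _ hv
      obtain ⟨s, hs⟩ : ∃ s : ℤ, σ = s := by
        rcases hφ.1 with rfl | rfl
        · exact ⟨1, by simp⟩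
        · exact ⟨-1, by simp⟩
      have hss : σ * σ = 1 := by
        rcases hφ.1 with rfl | rfl <;> norm_num
      have hpow : (2 : ℝ) ^ m * 2 ^ (k - m) = 2 ^ k := by
        rw [← zpow_add₀ (two_ne_zero' ℝ), add_sub_cancel]
      refine ⟨_, ⟨k - m, _, hL.add_mem _ _ hu (s * l), rfl⟩, ?_⟩
      have hgen : ∀ u, φ '' upright w (k - m) (u + 2 ^ (k - m) * w * ((s * l : ℤ) : ℝ)) =
          aff 0 (2 ^ k * w * l) • φ '' upright w (k - m) u := by
        intro u
        obtain ⟨h1, h2⟩ := hφ.image_upright (w := w) (k - m) u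
        obtain ⟨h3, h4⟩ := hφ.image_upright (w := w) (k - m)
          (u + 2 ^ (k - m) * w * ((s * l : ℤ) : ℝ))
        push_cast at h3 h4 ⊢
        rw [← hs] at h3 h4 ⊢
        rcases hφ.1 with h | h
        · rw [h1 h, h3 h, aff_smul_upright, zero_add, zpow_zero, one_mul, h]
          congr 1
          linear_combination w * l * hpow
        · rw [h2 h, h4 h, aff_smul_upright, zero_add, zpow_zero, one_mul, h]
          congr 1
          linear_combination w * l * hpow
      change φ '' _ = _
      rw [hgen, hn, aff_smul_upright, zero_add, zpow_zero, one_mul, hl]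

/-- The exponent of the scaling factor of an affine map. -/
def level (φ : ℍ ≃ᵢ ℍ) : ℤ := Int.log 2 (φ I).im

lemma IsAffine.level_eq {φ : ℍ ≃ᵢ ℍ} {σ : ℝ} {m : ℤ} {t : ℝ} (h : IsAffine φ σ m t) :
    level φ = m := by
  rw [level, (h.2 I).2, I_im, mul_one]
  exact_mod_cast Int.log_zpow (R := ℝ) (b := 2) (by norm_num) m

/-- The homomorphism sending a symmetry to the exponent of its scaling factor. -/
def levelHom (hw : 0 < w) (hL : IsGrid w L) :
    symmetryGroup (gridTiling w L) →* Multiplicative ℤ :=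
  MonoidHom.mk' (fun φ => Multiplicative.ofAdd (level φ)) (by
    rintro ⟨φ, hφ⟩ ⟨ψ, hψ⟩
    obtain ⟨σ, m, t, h⟩ := exists_isAffine hw hL hφ
    obtain ⟨τ, n, u, h'⟩ := exists_isAffine hw hL hψ
    rw [← ofAdd_add]
    congr 1
    simp only [Subgroup.coe_mul]
    rw [h.level_eq, h'.level_eq, (h.mul h').level_eq])

/-- A symmetry which is a translation along the horocycles is trivial. -/
lemma IsAffine.eq_one_of_translation (hw : 0 < w) (hL : IsGrid w L) {φ : ℍ ≃ᵢ ℍ} {t : ℝ}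
    (h : IsAffine φ 1 0 t) (hφ : φ ∈ symmetryGroup (gridTiling w L)) : φ = 1 := by
  rw [h.mem_symmetryGroup_iff hw hL] at hφ
  -- At a level with spacing larger than `|t|`, a grid point and its translate must coincide.
  obtain ⟨k, -, hk⟩ := IsGrid.exists_zpow_mul_gt hw |t| 0
  obtain ⟨u, hu⟩ := hL.nonempty k
  have h1 := hφ k u hu
  rw [zpow_zero, one_mul, one_mul, add_zero] at h1
  rw [abs_lt] at hk
  have := hL.eq_of_lt hw hu h1 (by linarith) (by linarith)
  have ht : t = 0 := by linarith
  subst ht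
  exact h.ext IsAffine.one

/-- A tiling with a symmetry that is a reflection in a line ending at `∞` has two pools. -/
lemma IsAffine.exists_mem_of_reflection (hw : 0 < w) (hL : IsGrid w L) {φ : ℍ ≃ᵢ ℍ} {t : ℝ}
    (h : IsAffine φ (-1) 0 t) (hφ : φ ∈ symmetryGroup (gridTiling w L)) : ∃ x, ∀ k, x ∈ L k := by
  rw [h.mem_symmetryGroup_iff hw hL] at hφ
  refine ⟨t / 2, fun k => ?_⟩
  -- One level higher than needed: `u` and its mirror image differ by a multiple of `2 ^ (k + 1) w`,
  -- so their midpoint `t / 2` differs from `u` by a multiple of `2 ^ k w`.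
  obtain ⟨u, hu⟩ := hL.nonempty (k + 1)
  have h1 := hφ _ u hu
  rw [zpow_zero, add_zero] at h1
  obtain ⟨n, hn⟩ := hL.exists_eq _ _ hu _ h1
  convert hL.add_mem k u (hL.succ_subset k hu) n using 1
  rw [zpow_add_one₀ (two_ne_zero' ℝ)] at hn
  linarith

lemma eq_one_of_level_eq_zero (hw : 0 < w) (hL : IsGrid w L) (hx : ¬ ∃ x, ∀ k, x ∈ L k)
    {φ : ℍ ≃ᵢ ℍ} (hφ : φ ∈ symmetryGroup (gridTiling w L)) (h : level φ = 0) : φ = 1 := by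
  obtain ⟨σ, m, t, h'⟩ := exists_isAffine hw hL hφ
  obtain rfl : m = 0 := h'.level_eq.symm.trans h
  rcases h'.1 with rfl | rfl
  · exact h'.eq_one_of_translation hw hL hφ
  · exact (hx (h'.exists_mem_of_reflection hw hL hφ)).elim

/-- The symmetry group of a tiling with one pool is infinite cyclic or trivial. -/
theorem symmetryGroup_equiv_int (hw : 0 < w) (hL : IsGrid w L) (hx : ¬ ∃ x, ∀ k, x ∈ L k)
    (hne : symmetryGroup (gridTiling w L) ≠ ⊥) :
    Nonempty (symmetryGroup (gridTiling w L) ≃* Multiplicative ℤ) := by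
  have hinj : Function.Injective (levelHom hw hL) := by
    rw [injective_iff_map_eq_one]
    rintro ⟨φ, hφ⟩ h
    exact Subtype.ext (eq_one_of_level_eq_zero hw hL hx hφ (ofAdd_eq_one.1 h))
  have hcyc : IsCyclic (symmetryGroup (gridTiling w L)) := isCyclic_of_injective _ hinj
  obtain ⟨φ, hφ1⟩ := Subgroup.ne_bot_iff_exists_ne_one.1 hne
  have hinf : Infinite (symmetryGroup (gridTiling w L)) := by
    refine Infinite.of_injective (fun n : ℤ => φ ^ n) fun n n' h => ?_
    have h1 := congrArg (levelHom hw hL) h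
    simp only [map_zpow] at h1
    have h2 : levelHom hw hL φ ≠ 1 := fun h => hφ1 (hinj (h.trans (map_one _).symm))
    have h3 : (levelHom hw hL φ).toAdd ≠ 0 := h2
    have h4 := congrArg Multiplicative.toAdd h1
    rw [toAdd_zpow, toAdd_zpow, smul_eq_mul, smul_eq_mul] at h4
    exact mul_right_cancel₀ h3 h4
  exact ⟨intCyclicMulEquiv.symm⟩

/-- The parity of an affine map: `1` if it reverses the orientation. -/
def parity (φ : ℍ ≃ᵢ ℍ) : ZMod 2 := if (φ (pt 1 1 one_pos)).re > (φ I).re then 0 else 1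

lemma IsAffine.parity_eq {φ : ℍ ≃ᵢ ℍ} {σ : ℝ} {m : ℤ} {t : ℝ} (h : IsAffine φ σ m t) :
    parity φ = if σ = 1 then 0 else 1 := by
  have hp : (0 : ℝ) < 2 ^ m := by positivity
  rw [parity, (h.2 I).1, (h.2 _).1, I_re, pt_re, mul_zero, mul_one]
  congr 1
  rcases h.1 with rfl | rfl
  · simp [hp]
  · simp only [gt_iff_lt, eq_iff_iff]
    constructor
    · intro h
      linarith
    · intro h
      norm_num at h

/-- The homomorphism sending a symmetry to the exponent of its scaling factor and its parity. -/
def levelParityHom (hw : 0 < w) (hL : IsGrid w L) :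
    symmetryGroup (gridTiling w L) →* Multiplicative ℤ × Multiplicative (ZMod 2) :=
  (levelHom hw hL).prod (MonoidHom.mk' (fun φ => Multiplicative.ofAdd (parity φ)) (by
    rintro ⟨φ, hφ⟩ ⟨ψ, hψ⟩
    obtain ⟨σ, m, t, h⟩ := exists_isAffine hw hL hφ
    obtain ⟨τ, n, u, h'⟩ := exists_isAffine hw hL hψ
    rw [← ofAdd_add]
    congr 1
    simp only [Subgroup.coe_mul]
    rw [h.parity_eq, h'.parity_eq, (h.mul h').parity_eq]
    rcases h.1 with rfl | rfl <;> rcases h'.1 with rfl | rfl <;> (norm_num; try rfl)))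

/-- The symmetry group of a tiling with two pools. -/
theorem symmetryGroup_equiv_prod (hw : 0 < w) (hL : IsGrid w L) {x : ℝ} (hx : ∀ k, x ∈ L k) :
    Nonempty (symmetryGroup (gridTiling w L) ≃* Multiplicative ℤ × Multiplicative (ZMod 2)) := by
  refine ⟨MulEquiv.ofBijective (levelParityHom hw hL) ⟨?_, ?_⟩⟩
  · rw [injective_iff_map_eq_one]
    rintro ⟨φ, hφ⟩ h
    obtain ⟨h1, h2⟩ := Prod.ext_iff.1 h
    have h1' : level φ = 0 := ofAdd_eq_one.1 h1
    have h2' : parity φ = 0 := ofAdd_eq_one.1 h2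
    obtain ⟨σ, m, t, h'⟩ := exists_isAffine hw hL hφ
    obtain rfl : m = 0 := h'.level_eq.symm.trans h1'
    rw [h'.parity_eq] at h2'
    obtain rfl : σ = 1 := by
      by_contra hne
      simp [hne] at h2'
    exact Subtype.ext (h'.eq_one_of_translation hw hL hφ)
  · rintro ⟨m, s⟩
    obtain ⟨σ, hσ, hs⟩ : ∃ σ : ℝ, (σ = 1 ∨ σ = -1) ∧
        (if σ = 1 then (0 : ZMod 2) else 1) = s.toAdd := by
      have h01 : ∀ s : ZMod 2, s = 0 ∨ s = 1 := by decide
      rcases h01 s.toAdd with h | h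
      · exact ⟨1, Or.inl rfl, by simp [h]⟩
      · exact ⟨-1, Or.inr rfl, by rw [if_neg (by norm_num), h]⟩
    -- The translation part is chosen so that `x` is fixed.
    obtain ⟨φ, hφ⟩ := IsAffine.exists_isometry hσ m.toAdd (x - σ * 2 ^ m.toAdd * x)
    have hmem : φ ∈ symmetryGroup (gridTiling w L) := by
      rw [hφ.mem_symmetryGroup_iff hw hL]
      intro k u hu
      obtain ⟨n, rfl⟩ := hL.exists_eq k x (hx k) u hu
      have hpow : (2 : ℝ) ^ (k + m.toAdd) = 2 ^ k * 2 ^ m.toAdd := zpow_add₀ (two_ne_zero' ℝ) _ _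
      rcases hσ with rfl | rfl
      · convert hL.add_mem _ x (hx (k + m.toAdd)) n using 1
        rw [hpow]
        ring
      · convert hL.add_mem _ x (hx (k + m.toAdd)) (-n) using 1
        rw [hpow]
        push_cast
        ring
    refine ⟨⟨φ, hmem⟩, Prod.ext ?_ ?_⟩
    · change Multiplicative.ofAdd (level φ) = m
      rw [hφ.level_eq, ofAdd_toAdd]
    · change Multiplicative.ofAdd (parity φ) = s
      rw [hφ.parity_eq, hs, ofAdd_toAdd]

/-- The symmetry groups of congruent tilings are conjugate. -/
lemma symmetryGroup_smul (g : SL(2, ℝ)) (𝒯 : Set (Set ℍ)) :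
    symmetryGroup (g • 𝒯) = (symmetryGroup 𝒯).map (MulAut.conj (slIso g)).toMonoidHom := by
  have key : ∀ (g : SL(2, ℝ)) (𝒯 : Set (Set ℍ)) (φ : ℍ ≃ᵢ ℍ), φ ∈ symmetryGroup 𝒯 →
      slIso g * φ * (slIso g)⁻¹ ∈ symmetryGroup (g • 𝒯) := by
    intro g 𝒯 φ hφ
    have hcomp : ∀ T : Set ℍ, (slIso g * φ * (slIso g)⁻¹) '' (g • T) = g • (φ '' T) := by
      intro T
      have h1 : (g • T : Set ℍ) = slIso g '' T := rfl
      have h2 : g • (φ '' T) = slIso g '' (φ '' T) := rfl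
      rw [h1, h2, ← Set.image_comp, ← Set.image_comp]
      refine Set.image_congr fun z _ => ?_
      simp only [Function.comp_apply, ← IsometryEquiv.mul_apply, inv_mul_cancel_right]
    rw [mem_symmetryGroup_iff] at hφ ⊢
    conv_rhs => rw [← hφ]
    have h3 : ∀ S : Set (Set ℍ), g • S = (fun T : Set ℍ => g • T) '' S := fun S => rfl
    rw [h3, h3, ← Set.image_comp, ← Set.image_comp]
    exact Set.image_congr fun T _ => hcomp T
  ext φ
  rw [Subgroup.mem_map]
  constructor
  · intro h
    refine ⟨(slIso g)⁻¹ * φ * slIso g, ?_, ?_⟩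
    · have := key g⁻¹ _ _ h
      rwa [inv_smul_smul, map_inv, inv_inv] at this
    · simp [MulAut.conj_apply, mul_assoc]
  · rintro ⟨ψ, hψ, rfl⟩
    exact key g 𝒯 ψ hψ

end Symmetry


/-! ### Periodic tails and symmetries -/

section Tails

variable {w : ℝ} {L : ℤ → Set ℝ} {g : SL(2, ℝ)}

lemma exists_edge_iff (hw : 0 < w) {k : ℤ} {t u : ℝ} :
    (∃ e, IsEdge w .a (g • upright w k t) e ∧ IsEdge w .b₁ (g • upright w (k + 1) u) e) ↔
      u = t := by
  constructor
  · rintro ⟨e, h1, h2⟩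
    rw [isEdge_upright_iff hw] at h1 h2
    have := edge_eq_cases hw (by simp) (MulAction.injective g (h1.symm.trans h2))
    simpa using this
  · rintro rfl
    exact ⟨_, (isEdge_upright_iff hw).2 rfl,
      (isEdge_upright_iff hw).2 (by rw [aff_smul_a_eq_b₁])⟩

lemma stepDown_upright_iff (hw : 0 < w) {k m : ℤ} {t u : ℝ} :
    StepDown w (g • upright w k t) (g • upright w m u) ↔
      m = k + 1 ∧ (u = t ∨ u = t - 2 ^ k * w) := by
  constructor
  · rintro ⟨e, h1, h2 | h2⟩
    all_goals
      rw [isEdge_upright_iff hw] at h1 h2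
      have := edge_eq_cases hw (by simp) (MulAction.injective g (h1.symm.trans h2))
      simp only [reduceCtorEq, true_and, false_and, or_false, false_or] at this
      tauto
  · rintro ⟨rfl, h⟩
    refine ⟨_, (isEdge_upright_iff hw).2 rfl, ?_⟩
    rcases h with rfl | rfl
    · exact Or.inl ((isEdge_upright_iff hw).2 (by rw [aff_smul_a_eq_b₁]))
    · exact Or.inr ((isEdge_upright_iff hw).2 (by rw [aff_smul_a_eq_b₂]))

/-- The `±1`-sequence of a tail in terms of the left sides of its tiles. -/
lemma tailSeq_eq_iff (hw : 0 < w) {k : ℤ} {v : ℕ → ℝ} {t : ℕ → Set ℍ}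
    (ht : ∀ i : ℕ, t i = g • upright w (k + i) (v i)) (i j : ℕ) :
    tailSeq w t i = tailSeq w t j ↔ (v (i + 1) = v i ↔ v (j + 1) = v j) := by
  have key : ∀ i, (∃ e, IsEdge w .a (t i) e ∧ IsEdge w .b₁ (t (i + 1)) e) ↔ v (i + 1) = v i := by
    intro i
    rw [ht, ht, Nat.cast_succ, ← add_assoc]
    exact exists_edge_iff hw
  unfold tailSeq
  simp only [key]
  split_ifs with h1 h2 h2 <;> simp [h1, h2]

/-- A nontrivial symmetry of a tiling with one pool yields a periodic tail. -/
theorem hasPeriodicTailSeq_of_symmetry (hw : 0 < w) (hL : IsGrid w L)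
    (hx : ¬ ∃ x, ∀ k, x ∈ L k) (hne : symmetryGroup (gridTiling w L) ≠ ⊥) :
    HasPeriodicTailSeq w (g • gridTiling w L) := by
  obtain ⟨φ, hφ, p, t, hp, hφ'⟩ : ∃ φ ∈ symmetryGroup (gridTiling w L), ∃ (p : ℕ) (t : ℝ),
      0 < p ∧ IsAffine φ 1 p t := by
    obtain ⟨⟨φ, hφ⟩, hφ1⟩ := Subgroup.ne_bot_iff_exists_ne_one.1 hne
    obtain ⟨σ, m, t, h⟩ := exists_isAffine hw hL hφ
    have hm : m ≠ 0 := by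
      rintro rfl
      exact hφ1 (Subtype.ext (eq_one_of_level_eq_zero hw hL hx hφ h.level_eq))
    -- Squaring makes the sign `σ` equal to `1`; it is applied to `φ` or `φ⁻¹`, whichever has
    -- positive level.
    have hsq : ∀ {ψ σ n u}, ψ ∈ symmetryGroup (gridTiling w L) → IsAffine ψ σ n u → 0 < n →
        ∃ φ ∈ symmetryGroup (gridTiling w L), ∃ (p : ℕ) (t : ℝ), 0 < p ∧ IsAffine φ 1 p t := by
      intro ψ σ n u hψ h hn
      refine ⟨ψ * ψ, mul_mem hψ hψ, (n + n).toNat, σ * 2 ^ n * u + u, by omega, ?_⟩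
      have hs : σ * σ = 1 := by rcases h.1 with rfl | rfl <;> norm_num
      have := h.mul h
      rwa [hs, ← Int.toNat_of_nonneg (a := n + n) (by omega)] at this
    rcases hm.lt_or_gt with hm | hm
    · exact hsq (inv_mem hφ) h.inv (by omega)
    · exact hsq hφ h hm
  have hpow : (1 : ℝ) < 2 ^ (p : ℤ) := one_lt_zpow₀ one_lt_two (by omega)
  -- The real fixed point of the symmetry. The tiles whose strips contain `c` form a tail, and the
  -- symmetry moves it `p` steps along itself.
  obtain ⟨c, hc⟩ : ∃ c : ℝ, 2 ^ (p : ℤ) * c + t = c := by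
    refine ⟨t / (1 - 2 ^ (p : ℤ)), ?_⟩
    have : (1 : ℝ) - 2 ^ (p : ℤ) ≠ 0 := by linarith
    field_simp
    ring
  rw [hφ'.mem_symmetryGroup_iff hw hL] at hφ
  choose a ha h1 h2 using fun k => hL.exists_floor hw k c
  have hshift : ∀ k, a (k + p) = 2 ^ (p : ℤ) * a k + t := by
    intro k
    have h3 := hφ k (a k) (ha k)
    rw [one_mul] at h3
    have e : (2 : ℝ) ^ (k + p) = 2 ^ (p : ℤ) * 2 ^ k := by
      rw [zpow_add₀ (two_ne_zero' ℝ), mul_comm]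
    refine hL.eq_of_lt hw (ha _) h3 ?_ ?_
    · have := h1 (k + p)
      have := mul_lt_mul_of_pos_left (h2 k) (zero_lt_one.trans hpow)
      rw [e]
      linarith
    · have := h2 (k + p)
      have := mul_le_mul_of_nonneg_left (h1 k) (zero_lt_one.trans hpow).le
      linarith
  refine ⟨g • upright w 0 (a 0), smul_upright_mem (ha 0), fun i => g • upright w i (a i),
    ⟨rfl, fun i => smul_upright_mem (ha i), ?_, ?_⟩, p, hp, ?_⟩
  · intro i j h
    exact_mod_cast (upright_injective hw h).1
  · intro i
    rw [stepDown_upright_iff hw, Nat.cast_succ]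
    exact ⟨rfl, hL.parent_cases hw (ha i) (ha _) (h1 _) (h2 _) (h1 _) (h2 _)⟩
  · intro i
    rw [tailSeq_eq_iff hw (k := 0) (v := fun i => a i) (g := g) fun i => by rw [zero_add]]
    simp only [Nat.cast_add, Nat.cast_one]
    rw [add_right_comm, hshift, hshift]
    have hpos := (zero_lt_one.trans hpow).ne'
    rw [add_left_inj, mul_right_inj' hpos]

/-- A periodic tail yields a nontrivial symmetry. -/
theorem symmetryGroup_ne_bot (hw : 0 < w) (hL : IsGrid w L)
    (h : HasPeriodicTailSeq w (g • gridTiling w L)) : symmetryGroup (gridTiling w L) ≠ ⊥ := by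
  obtain ⟨T, -, t, ⟨-, ht, -, hstep⟩, p, hp, hper⟩ := h
  have hex : ∀ i, ∃ k u, u ∈ L k ∧ t i = g • upright w k u := by
    intro i
    obtain ⟨_, ⟨k, u, hu, rfl⟩, h⟩ := ht i
    exact ⟨k, u, hu, h.symm⟩
  choose k v hv htv using hex
  have hs : ∀ i, k (i + 1) = k i + 1 ∧ (v (i + 1) = v i ∨ v (i + 1) = v i - 2 ^ k i * w) := by
    intro i
    have := hstep i
    rwa [htv, htv, stepDown_upright_iff hw] at this
  have hk : ∀ i : ℕ, k i = k 0 + i := by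
    intro i
    induction i with
    | zero => simp
    | succ i ih =>
      rw [(hs i).1, ih]
      push_cast
      ring
  have hper' : ∀ i, v (i + p + 1) = v (i + p) ↔ v (i + 1) = v i := fun i =>
    (tailSeq_eq_iff hw (g := g) (fun i => by rw [htv, hk]) _ _).1 (hper i)
  -- The affine map that takes the tile `t 0` to `t p`; by periodicity it takes `t i` to `t (i + p)`
  -- for every `i`.
  obtain ⟨φ, hφ⟩ := IsAffine.exists_isometry (Or.inl rfl : (1 : ℝ) = 1 ∨ (1 : ℝ) = -1) p
    (v p - 2 ^ (p : ℤ) * v 0)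
  have hshift : ∀ i, v (i + p) = 2 ^ (p : ℤ) * v i + (v p - 2 ^ (p : ℤ) * v 0) := by
    intro i
    induction i with
    | zero =>
      rw [zero_add]
      ring
    | succ i ih =>
      have hw0 : ∀ j, (2 : ℝ) ^ k j * w ≠ 0 := fun j => by positivity
      have e : (2 : ℝ) ^ k (i + p) = 2 ^ (p : ℤ) * 2 ^ k i := by
        rw [hk, hk i, ← zpow_add₀ (two_ne_zero' ℝ)]
        congr 1
        push_cast
        ring
      rw [add_right_comm]
      by_cases h : v (i + 1) = v i
      · rw [(hper' i).2 h, h, ih]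
      · rw [(hs i).2.resolve_left h, (hs (i + p)).2.resolve_left (fun h' => h ((hper' i).1 h')), ih,
          e]
        ring
  have hmem : φ ∈ symmetryGroup (gridTiling w L) := by
    rw [hφ.mem_symmetryGroup_iff hw hL]
    intro n u hu
    -- The tail reaches levels above `n`, and by nestedness one of its left ends there represents
    -- the coset `L n`.
    obtain ⟨i, hi⟩ : ∃ i : ℕ, n ≤ k i := by
      refine ⟨(n - k 0).toNat, ?_⟩
      rw [hk]
      have := Int.self_le_toNat (n - k 0)
      linarith
    obtain ⟨l, rfl⟩ := hL.exists_eq n _ (hL.antitone hi (hv i)) u hu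
    have h1 : v (i + p) ∈ L (n + p) := by
      refine hL.antitone ?_ (hv (i + p))
      rw [hk] at hi ⊢
      push_cast
      linarith
    convert hL.add_mem _ _ h1 l using 1
    rw [hshift, zpow_add₀ (two_ne_zero' ℝ)]
    ring
  intro hbot
  rw [hbot, Subgroup.mem_bot] at hmem
  subst hmem
  have h1 := hφ.level_eq
  rw [IsAffine.one.level_eq] at h1
  omega

end Tails

end Boroczky

end

theorem mainTheorem3 (w : ℝ) (hw : 0 < w) (𝒯 : Set (Set UpperHalfPlane))
    (h𝒯 : Boroczky.IsBTiling w 𝒯) :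
    ((Boroczky.pools w 𝒯).encard = 2 →
      Nonempty (Boroczky.symmetryGroup 𝒯 ≃* Multiplicative ℤ × Multiplicative (ZMod 2))) ∧
    ((Boroczky.pools w 𝒯).encard = 1 ∧ Boroczky.HasPeriodicTailSeq w 𝒯 →
      Nonempty (Boroczky.symmetryGroup 𝒯 ≃* Multiplicative ℤ)) ∧
    (¬ (Boroczky.pools w 𝒯).encard = 2 ∧
        ¬ ((Boroczky.pools w 𝒯).encard = 1 ∧ Boroczky.HasPeriodicTailSeq w 𝒯) →
      Boroczky.symmetryGroup 𝒯 = ⊥) := by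
  obtain ⟨g, L, hL, rfl⟩ := h𝒯.exists_grid hw
  have hconj := Boroczky.symmetryGroup_smul g (Boroczky.gridTiling w L)
  have e := (Boroczky.symmetryGroup (Boroczky.gridTiling w L)).equivMapOfInjective
    (MulAut.conj (Boroczky.slIso g)).toMonoidHom (MulAut.conj (Boroczky.slIso g)).injective
  rw [← hconj] at e
  -- A point common to all levels decides between two pools and one, so no other number occurs.
  by_cases hx : ∃ x, ∀ k, x ∈ L k
  · obtain ⟨x, hx⟩ := hx
    have h2 := Boroczky.encard_pools_eq_two (g := g) hw hL hx
    refine ⟨fun _ => ?_, fun h => ?_, fun h => (h.1 h2).elim⟩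
    · obtain ⟨f⟩ := Boroczky.symmetryGroup_equiv_prod hw hL hx
      exact ⟨e.symm.trans f⟩
    · rw [h2] at h
      exact absurd h.1 (by norm_num)
  · have h1 := Boroczky.encard_pools_eq_one (g := g) hw hL hx
    refine ⟨fun h => ?_, fun h => ?_, fun h => ?_⟩
    · rw [h1] at h
      exact absurd h (by norm_num)
    · obtain ⟨f⟩ := Boroczky.symmetryGroup_equiv_int hw hL hx
        (Boroczky.symmetryGroup_ne_bot hw hL h.2)
      exact ⟨e.symm.trans f⟩
    · by_contra hne
      refine h.2 ⟨h1, Boroczky.hasPeriodicTailSeq_of_symmetry hw hL hx fun hbot => hne ?_⟩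
      rw [hconj, hbot, Subgroup.map_bot]
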